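/- Let $\Omega\subset\mathbb R^2$ be a bounded (nonempty, connected, open) domain with smooth boundary having $n\ge 0$ holes, i.e. $\mathbb R^2\setminus\Omega$ has exactly $n$ bounded connected components. Let $A=A_1\,dx_1+A_2\,dx_2$ be a closed real $1$-form on $\Omega$, smooth up to the boundary, and let $$\lambda_1(\Omega,A)=\inf\left\{\frac{\int_\Omega|\nabla u-iuA^\sharp|^2}{\int_\Omega|u|^2}\;:\;u\in H^1(\Omega,\mathbb C)\setminus\{0\}\right\},\qquad A^\sharp=(A_1,A_2),$$ be the first eigenvalue of the magnetic Laplacian $\Delta_A=(i\nabla+A^\sharp)^2$ on $\Omega$ with magnetic Neumann boundary conditions. Then $$\lambda_1(\Omega,A)\le C\,\frac{n}{|\Omega|},$$ where $|\Omega|$ is the area of $\Omega$ and $C$ is a universal constant (independent of $\Omega$, $n$ and $A$); one can take $C=544\pi$. -/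

import Mathlib

open MeasureTheory
open scoped ContDiff

noncomputable section

namespace MagneticNeumann

/-- The Euclidean plane. -/
abbrev Plane : Type := EuclideanSpace ℝ (Fin 2)

/-- The standard basis vectors of the plane. -/
def e (j : Fin 2) : Plane := EuclideanSpace.single j 1

/-- The boundary of `Ω` is smooth: near each boundary point, `Ω` is the sublevel set `{ρ < 0}` of a
smooth function `ρ` with nonvanishing differential at that point (which lies on `{ρ = 0}`). -/
def HasSmoothBoundary (Ω : Set Plane) : Prop :=
  ∀ x ∈ frontier Ω, ∃ (U : Set Plane) (ρ : Plane → ℝ),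
    IsOpen U ∧ x ∈ U ∧ ContDiffOn ℝ ∞ ρ U ∧ ρ x = 0 ∧ fderiv ℝ ρ x ≠ 0 ∧
      Ω ∩ U = {y ∈ U | ρ y < 0}

/-- Bounded (nonempty, open, connected) domains of the plane with smooth boundary. -/
structure IsSmoothBoundedDomain (Ω : Set Plane) : Prop where
  isOpen : IsOpen Ω
  isConnected : IsConnected Ω
  isBounded : Bornology.IsBounded Ω
  smoothBoundary : HasSmoothBoundary Ω

/-- The holes of `Ω`: the bounded connected components of its complement. -/
def holes (Ω : Set Plane) : Set (Set Plane) :=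
  {K | Bornology.IsBounded K ∧ ∃ x ∈ Ωᶜ, K = connectedComponentIn Ωᶜ x}

/-- Real differential `1`-forms on the plane (only the values on the closure of the domain matter). -/
abbrev OneForm : Type := Plane → Plane [⋀^Fin 1]→L[ℝ] ℝ

/-- The components `A_j = A(e_j)` of a `1`-form, which are also those of the dual vector field. -/
def OneForm.coeff (A : OneForm) (j : Fin 2) (x : Plane) : ℝ := A x ![e j]

/-- A closed potential on `Ω`: a `1`-form, smooth up to the boundary, with `dA = 0` in `Ω`. -/
structure IsClosedPotential (Ω : Set Plane) (A : OneForm) : Prop where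
  smooth : ContDiffOn ℝ ∞ A (closure Ω)
  closed : ∀ x ∈ Ω, extDeriv A x = 0

/-- `g` is the weak `j`-th partial derivative of `u` on `Ω`. -/
def IsWeakPartialDeriv (Ω : Set Plane) (j : Fin 2) (u g : Plane → ℂ) : Prop :=
  ∀ φ : Plane → ℝ, ContDiff ℝ ∞ φ → HasCompactSupport φ → tsupport φ ⊆ Ω →
    ∫ x in Ω, u x * (fderiv ℝ φ x (e j) : ℂ) = - ∫ x in Ω, g x * (φ x : ℂ)

/-- `u` belongs to the Sobolev space `H¹(Ω, ℂ)` and `G` is its weak gradient. -/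
structure IsH1WithGradient (Ω : Set Plane) (u : Plane → ℂ) (G : Fin 2 → Plane → ℂ) : Prop where
  memLp : MemLp u 2 (volume.restrict Ω)
  memLp_grad : ∀ j, MemLp (G j) 2 (volume.restrict Ω)
  weak_deriv : ∀ j, IsWeakPartialDeriv Ω j u (G j)

/-- The magnetic energy `∫_Ω |∇u - i u A♯|²`, where `G` is the weak gradient of `u`. -/
def magneticEnergy (Ω : Set Plane) (A : OneForm) (u : Plane → ℂ) (G : Fin 2 → Plane → ℂ) : ℝ :=
  ∫ x in Ω, ∑ j : Fin 2, ‖G j x - Complex.I * u x * (A.coeff j x : ℂ)‖ ^ 2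

/-- The values of the magnetic Rayleigh quotient on `H¹(Ω, ℂ) \ {0}`. -/
def rayleighQuotients (Ω : Set Plane) (A : OneForm) : Set ℝ :=
  {R | ∃ (u : Plane → ℂ) (G : Fin 2 → Plane → ℂ), IsH1WithGradient Ω u G ∧
    ¬ (u =ᵐ[volume.restrict Ω] 0) ∧
    R = magneticEnergy Ω A u G / ∫ x in Ω, ‖u x‖ ^ 2}

/-- The first eigenvalue of the magnetic Neumann Laplacian on `Ω` with potential `A`, as the infimum
of the Rayleigh quotient. -/
def lambda1 (Ω : Set Plane) (A : OneForm) : ℝ := sInf (rayleighQuotients Ω A)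

end MagneticNeumann

end

noncomputable section

namespace MagneticNeumann

open Set Metric Filter Topology

/-! ### Discrete forms on the integer lattice -/

/-! Choose one point in each hole and cover the plane by square grids of mesh `s`. An open grid
square containing no chosen point swallows no hole, so the complement of its intersection with `Ω`
is connected and `A = dφ` there. Multiplying a real cutoff by `exp (iφ)` gauges `A` away, and the
magnetic energy density becomes the squared gradient of the cutoff.

Four grids, shifted by half a mesh, carry cutoffs whose squares sum to 1 and whose squared gradients
sum to at most `8π²/s²`. Each cutoff vanishes to second order on the lines of its grid, so unrelated
phases on adjacent squares glue differentiably. Dropping the squares that hold chosen points costs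
area at most `n s²` per grid. Adding the four Rayleigh inequalities gives `λ₁ (|Ω| - 4 n s²) ≤ 8π²
|Ω| / s²` (`lambda1_mul_volume_sub_le`), and `s² = |Ω| / (8n)` concludes; for `n = 0` let `s` be
large.

The topological input is `IsLocallyExactOn.exists_primitive`: a locally exact form on a bounded open
`W` with connected complement is exact. It is proved on a lattice. Edge integrals have zero
circulation around cells inside `W`; the circulation around any other cell can be carried off to
infinity through edges not contained in `W`, because the complement is connected. The corrected
discrete form has a potential, which gives a primitive away from the boundary; then the mesh tends
to zero. -/

/-- The circulation around the unit cells of a discrete `1`-form, given by its values on horizontal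
and vertical edges (indexed by their lower left endpoints). -/
def curl (h v : ℤ × ℤ → ℝ) (c : ℤ × ℤ) : ℝ :=
  h c + v (c.1 + 1, c.2) - h (c.1, c.2 + 1) - v c

lemma exists_int_sum (g : ℤ → ℝ) : ∃ G : ℤ → ℝ, G 0 = 0 ∧ ∀ i, G (i + 1) - G i = g i := by
  refine ⟨fun i ↦ ∑ k ∈ Finset.range i.toNat, g k
    - ∑ k ∈ Finset.range (-i).toNat, g (-(k : ℤ) - 1), by simp, fun i ↦ ?_⟩
  obtain ⟨n, rfl | rfl⟩ := i.eq_nat_or_neg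
  · have h1 : ((n : ℤ) + 1).toNat = n + 1 := by lia
    have h2 : (-((n : ℤ) + 1)).toNat = 0 := by lia
    have h3 : (-(n : ℤ)).toNat = 0 := by lia
    simp only [h1, h2, h3, Finset.sum_range_succ]
    simp
  · cases n with
    | zero => simp
    | succ n =>
      have h1 : (-((n + 1 : ℕ) : ℤ) + 1).toNat = 0 := by lia
      have h2 : (-(-((n + 1 : ℕ) : ℤ) + 1)).toNat = n := by lia
      have h3 : (-((n + 1 : ℕ) : ℤ)).toNat = 0 := by lia
      have h4 : (-(-((n + 1 : ℕ) : ℤ))).toNat = n + 1 := by lia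
      have h5 : -(n : ℤ) - 1 = -((n + 1 : ℕ) : ℤ) := by push_cast; ring
      simp only [h1, h2, h3, h4, Finset.sum_range_succ, h5]
      ring

/-- Discrete Poincaré lemma on the integer lattice. -/
lemma exists_potential_of_curl_eq_zero {h v : ℤ × ℤ → ℝ} (H : ∀ c, curl h v c = 0) :
    ∃ m : ℤ × ℤ → ℝ, (∀ c : ℤ × ℤ, m (c.1 + 1, c.2) - m c = h c) ∧
      ∀ c : ℤ × ℤ, m (c.1, c.2 + 1) - m c = v c := by
  obtain ⟨F, -, hF⟩ := exists_int_sum fun i ↦ h (i, 0)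
  choose G hG0 hG using fun i : ℤ ↦ exists_int_sum fun j ↦ v (i, j)
  -- Integrate `h` along the axis, then `v` up each column. Vertical increments are right by
  -- construction; zero circulation carries the horizontal ones from row to row.
  refine ⟨fun c ↦ F c.1 + G c.1 c.2, fun ⟨i, j⟩ ↦ ?_, fun ⟨i, j⟩ ↦ ?_⟩
  · have key : ∀ k : ℤ, (F (i + 1) + G (i + 1) (k + 1) - (F i + G i (k + 1)) = h (i, k + 1)) ↔
        (F (i + 1) + G (i + 1) k - (F i + G i k) = h (i, k)) := by
      intro k
      have h1 := H (i, k)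
      have h2 := hG i k
      have h3 := hG (i + 1) k
      simp only [curl] at h1
      constructor <;> intro h4 <;> linarith
    induction j with
    | zero => simp [hG0, hF]
    | succ k ih => exact (key k).2 ih
    | pred k ih =>
      have := key (-(k : ℤ) - 1)
      rw [sub_add_cancel] at this
      exact this.1 ih
  · simp [hG]

/-- A discrete `2`-form `w` is a relative boundary if it is the circulation of a discrete `1`-form
supported on the horizontal edges in `H` and the vertical edges in `V`. -/
def IsRelCurl (H V : Set (ℤ × ℤ)) (w : ℤ × ℤ → ℝ) : Prop :=
  ∃ h v : ℤ × ℤ → ℝ, (∀ e ∉ H, h e = 0) ∧ (∀ e ∉ V, v e = 0) ∧ ∀ c, curl h v c = w c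

namespace IsRelCurl

variable {H V : Set (ℤ × ℤ)} {w w' : ℤ × ℤ → ℝ}

lemma zero : IsRelCurl H V 0 := ⟨0, 0, by simp, by simp, by simp [curl]⟩

lemma add (hw : IsRelCurl H V w) (hw' : IsRelCurl H V w') : IsRelCurl H V (w + w') := by
  obtain ⟨h, v, h1, h2, h3⟩ := hw
  obtain ⟨h', v', h1', h2', h3'⟩ := hw'
  refine ⟨h + h', v + v', fun e he ↦ by simp [h1 e he, h1' e he],
    fun e he ↦ by simp [h2 e he, h2' e he], fun c ↦ ?_⟩
  rw [Pi.add_apply, ← h3, ← h3']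
  simp only [curl, Pi.add_apply]
  ring

lemma smul (r : ℝ) (hw : IsRelCurl H V w) : IsRelCurl H V (r • w) := by
  obtain ⟨h, v, h1, h2, h3⟩ := hw
  refine ⟨r • h, r • v, fun e he ↦ by simp [h1 e he], fun e he ↦ by simp [h2 e he], fun c ↦ ?_⟩
  rw [Pi.smul_apply, ← h3]
  simp only [curl, Pi.smul_apply, smul_eq_mul]
  ring

/-- The unit form on one horizontal edge has circulation `1` on the cell above it and `-1` on the
cell below, so an indicator can be moved across any allowed edge. -/
lemma single_iff_of_mem_left {e : ℤ × ℤ} (he : e ∈ H) :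
    IsRelCurl H V (Pi.single e 1) ↔ IsRelCurl H V (Pi.single (e.1, e.2 - 1) 1) := by
  have key : IsRelCurl H V (Pi.single e 1 - Pi.single (e.1, e.2 - 1) 1) := by
    refine ⟨Pi.single e 1, 0, fun e' he' ↦ ?_, by simp, fun c ↦ ?_⟩
    · rw [Pi.single_apply, if_neg]
      rintro rfl
      exact he' he
    · obtain ⟨i, j⟩ := c
      obtain ⟨i', j'⟩ := e
      simp only [curl, Pi.single_apply, Pi.zero_apply, Pi.sub_apply, Prod.mk.injEq, eq_sub_iff_add_eq]
      ring
  constructor <;> intro h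
  · simpa using h.add (key.smul (-1))
  · simpa using h.add key

lemma single_iff_of_mem_right {e : ℤ × ℤ} (he : e ∈ V) :
    IsRelCurl H V (Pi.single e 1) ↔ IsRelCurl H V (Pi.single (e.1 - 1, e.2) 1) := by
  have key : IsRelCurl H V (Pi.single (e.1 - 1, e.2) 1 - Pi.single e 1) := by
    refine ⟨0, Pi.single e 1, by simp, fun e' he' ↦ ?_, fun c ↦ ?_⟩
    · rw [Pi.single_apply, if_neg]
      rintro rfl
      exact he' he
    · obtain ⟨i, j⟩ := c
      obtain ⟨i', j'⟩ := e
      simp only [curl, Pi.single_apply, Pi.zero_apply, Pi.sub_apply, Prod.mk.injEq, eq_sub_iff_add_eq]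
      ring
  constructor <;> intro h
  · simpa using h.add key
  · simpa using h.add (key.smul (-1))

/-- The cell is pushed up to infinity: with the value `-1` on every higher edge of the column,
contributions cancel in all cells but the lowest. -/
lemma single_of_forall_above {i j : ℤ} (h : ∀ k, j < k → (i, k) ∈ H) :
    IsRelCurl H V (Pi.single (i, j) 1) := by
  refine ⟨fun e ↦ if e.1 = i ∧ j < e.2 then -1 else 0, 0, fun e he ↦ if_neg ?_, by simp, ?_⟩
  · rintro ⟨rfl, h'⟩
    exact he (h _ h')
  · rintro ⟨a, b⟩
    simp only [curl, Pi.single_apply, Pi.zero_apply, Prod.mk.injEq]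
    grind

/-- A discrete `1`-form whose circulation is finitely supported on cells whose indicators are
relative boundaries has a potential, away from the edges in `H` and `V`. -/
lemma exists_potential {h v : ℤ × ℤ → ℝ} (hfin : {c | curl h v c ≠ 0}.Finite)
    (hc : ∀ c, curl h v c ≠ 0 → IsRelCurl H V (Pi.single c 1)) :
    ∃ m : ℤ × ℤ → ℝ, (∀ c : ℤ × ℤ, c ∉ H → m (c.1 + 1, c.2) - m c = h c) ∧
      ∀ c : ℤ × ℤ, c ∉ V → m (c.1, c.2 + 1) - m c = v c := by
  have h1 : IsRelCurl H V (∑ c ∈ hfin.toFinset, curl h v c • Pi.single c (1 : ℝ)) := by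
    refine Finset.sum_induction _ (IsRelCurl H V) (fun _ _ ↦ add) zero fun c hc' ↦ ?_
    exact (hc c (by simpa using hc')).smul _
  have h2 : (∑ c ∈ hfin.toFinset, curl h v c • Pi.single c (1 : ℝ)) = curl h v := by
    ext c
    simp only [Finset.sum_apply, Pi.smul_apply, Pi.single_apply, smul_eq_mul, mul_ite, mul_one,
      mul_zero, Finset.sum_ite_eq]
    simp
    tauto
  rw [h2] at h1
  obtain ⟨h', v', hh, hv, hcurl⟩ := h1
  -- The corrected form is closed, and unchanged off `H` and `V`.
  obtain ⟨m, hm1, hm2⟩ := exists_potential_of_curl_eq_zero (h := h - h') (v := v - v') fun c ↦ by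
    have := hcurl c
    simp only [curl, Pi.sub_apply] at this ⊢
    linarith
  exact ⟨m, fun c hc ↦ by simp [hm1, hh c hc], fun c hc ↦ by simp [hm2, hv c hc]⟩

end IsRelCurl

/-! ### Exactness of closed forms on open sets with connected complement -/

/-- `ψ` is a primitive of the form `η` on `C`. -/
def IsPrimitiveOn (η : Plane → Plane →L[ℝ] ℝ) (C : Set Plane) (ψ : Plane → ℝ) : Prop :=
  ∀ x ∈ C, HasFDerivAt ψ (η x) x

/-- `η` is exact on the open convex subsets of `W`. -/
def IsLocallyExactOn (η : Plane → Plane →L[ℝ] ℝ) (W : Set Plane) : Prop :=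
  ∀ C ⊆ W, IsOpen C → Convex ℝ C → ∃ ψ, IsPrimitiveOn η C ψ

variable {η : Plane → Plane →L[ℝ] ℝ} {W C : Set Plane}

lemma IsPrimitiveOn.sub_eq_sub {ψ ψ' : Plane → ℝ} (h : IsPrimitiveOn η C ψ)
    (h' : IsPrimitiveOn η C ψ') (hC : Convex ℝ C) {p q : Plane} (hp : p ∈ C) (hq : q ∈ C) :
    ψ q - ψ p = ψ' q - ψ' p := by
  have := hC.norm_image_sub_le_of_norm_hasFDerivWithin_le (C := 0) (f := fun x ↦ ψ x - ψ' x)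
    (f' := fun x ↦ η x - η x) (fun x hx ↦ ((h x hx).sub (h' x hx)).hasFDerivWithinAt)
    (by simp) hp hq
  rw [zero_mul, norm_le_zero_iff] at this
  linarith

/-- The integrals of a locally exact form along segments. -/
lemma IsLocallyExactOn.exists_integral (η : Plane → Plane →L[ℝ] ℝ) (W : Set Plane) :
    ∃ I : Plane → Plane → ℝ, ∀ C ⊆ W, IsOpen C → Convex ℝ C → ∀ ψ, IsPrimitiveOn η C ψ →
      ∀ p ∈ C, ∀ q ∈ C, I p q = ψ q - ψ p := by
  have key : ∀ p q : Plane, ∃ r : ℝ, ∀ C ⊆ W, IsOpen C → Convex ℝ C → ∀ ψ, IsPrimitiveOn η C ψ →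
      p ∈ C → q ∈ C → r = ψ q - ψ p := by
    intro p q
    by_cases h : ∃ C, C ⊆ W ∧ IsOpen C ∧ Convex ℝ C ∧ ∃ ψ, IsPrimitiveOn η C ψ ∧ p ∈ C ∧ q ∈ C
    · obtain ⟨C, -, -, hC, ψ, hψ, hp, hq⟩ := h
      refine ⟨ψ q - ψ p, fun C' _ _ hC' ψ' hψ' hp' hq' ↦ ?_⟩
      -- The two convex sets meet in a convex set containing `p` and `q`, so the value does not
      -- depend on the choice of `C`.
      exact IsPrimitiveOn.sub_eq_sub (C := C ∩ C') (fun x hx ↦ hψ x hx.1) (fun x hx ↦ hψ' x hx.2)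
        (hC.inter hC') ⟨hp, hp'⟩ ⟨hq, hq'⟩
    · exact ⟨0, fun C h1 h2 h3 ψ h4 hp hq ↦ (h ⟨C, h1, h2, h3, ψ, h4, hp, hq⟩).elim⟩
  choose I hI using key
  exact ⟨I, fun C h1 h2 h3 ψ h4 p hp q hq ↦ hI p q C h1 h2 h3 ψ h4 hp hq⟩

/-! ### The square lattice of mesh `δ` and its cells -/

/-- The vertices of the square lattice of mesh `δ`. -/
def vertex (δ : ℝ) (c : ℤ × ℤ) : Plane := !₂[δ * c.1, δ * c.2]

/-- The closed rectangle of the lattice of mesh `δ` with opposite vertices `a` and `b`. -/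
def latticeRect (δ : ℝ) (a b : ℤ × ℤ) : Set Plane :=
  {x | δ * a.1 ≤ x 0 ∧ x 0 ≤ δ * b.1 ∧ δ * a.2 ≤ x 1 ∧ x 1 ≤ δ * b.2}

/-- The closed cell of the square lattice of mesh `δ` with lower left vertex `c`. -/
def cell (δ : ℝ) (c : ℤ × ℤ) : Set Plane := latticeRect δ c (c.1 + 1, c.2 + 1)

/-- The horizontal edges of the lattice which are not contained in `W`. -/
def cutHorizontal (δ : ℝ) (W : Set Plane) : Set (ℤ × ℤ) :=
  {c | ¬ latticeRect δ c (c.1 + 1, c.2) ⊆ W}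

/-- The vertical edges of the lattice which are not contained in `W`. -/
def cutVertical (δ : ℝ) (W : Set Plane) : Set (ℤ × ℤ) :=
  {c | ¬ latticeRect δ c (c.1, c.2 + 1) ⊆ W}

@[simp] lemma vertex_zero (δ : ℝ) (c : ℤ × ℤ) : vertex δ c 0 = δ * c.1 := rfl
@[simp] lemma vertex_one (δ : ℝ) (c : ℤ × ℤ) : vertex δ c 1 = δ * c.2 := rfl

lemma continuous_coord (j : Fin 2) : Continuous fun x : Plane ↦ x j := by fun_prop

lemma isLinearMap_coord (j : Fin 2) : IsLinearMap ℝ fun x : Plane ↦ x j :=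
  ⟨fun _ _ ↦ rfl, fun _ _ ↦ rfl⟩

lemma convex_latticeRect (δ : ℝ) (a b : ℤ × ℤ) : Convex ℝ (latticeRect δ a b) :=
  (convex_halfSpace_ge (isLinearMap_coord 0) _).inter <|
    (convex_halfSpace_le (isLinearMap_coord 0) _).inter <|
      (convex_halfSpace_ge (isLinearMap_coord 1) _).inter <|
        convex_halfSpace_le (isLinearMap_coord 1) _

lemma isClosed_latticeRect (δ : ℝ) (a b : ℤ × ℤ) : IsClosed (latticeRect δ a b) :=
  (isClosed_le continuous_const (continuous_coord 0)).inter <|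
    (isClosed_le (continuous_coord 0) continuous_const).inter <|
      (isClosed_le continuous_const (continuous_coord 1)).inter <|
        isClosed_le (continuous_coord 1) continuous_const

lemma norm_le_abs_add_abs (x : Plane) : ‖x‖ ≤ |x 0| + |x 1| := by
  rw [EuclideanSpace.norm_eq, Fin.sum_univ_two]
  refine Real.sqrt_le_iff.2 ⟨by positivity, ?_⟩
  simp only [Real.norm_eq_abs]
  nlinarith [abs_nonneg (x 0), abs_nonneg (x 1)]

lemma abs_coord_le_norm (x : Plane) (j : Fin 2) : |x j| ≤ ‖x‖ := by
  simpa using PiLp.norm_apply_le x j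

lemma isBounded_latticeRect (δ : ℝ) (a b : ℤ × ℤ) : Bornology.IsBounded (latticeRect δ a b) := by
  refine isBounded_iff_forall_norm_le.2
    ⟨max |δ * a.1| |δ * b.1| + max |δ * a.2| |δ * b.2|, fun x hx ↦ ?_⟩
  exact (norm_le_abs_add_abs x).trans
    (add_le_add (abs_le_max_abs_abs hx.1 hx.2.1) (abs_le_max_abs_abs hx.2.2.1 hx.2.2.2))

lemma isCompact_latticeRect (δ : ℝ) (a b : ℤ × ℤ) : IsCompact (latticeRect δ a b) :=
  isCompact_of_isClosed_isBounded (isClosed_latticeRect δ a b) (isBounded_latticeRect δ a b)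

lemma vertex_mem_latticeRect {δ : ℝ} (hδ : 0 < δ) {a b c : ℤ × ℤ} (h1 : a ≤ c) (h2 : c ≤ b) :
    vertex δ c ∈ latticeRect δ a b := by
  refine ⟨?_, ?_, ?_, ?_⟩ <;> simp only [vertex_zero, vertex_one] <;> gcongr
  exacts [h1.1, h2.1, h1.2, h2.2]

/-- A locally exact form is exact near each rectangle contained in `W`. -/
lemma IsLocallyExactOn.exists_primitive_near_latticeRect (hη : IsLocallyExactOn η W)
    (hW : IsOpen W) {δ : ℝ} {a b : ℤ × ℤ} (h : latticeRect δ a b ⊆ W) :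
    ∃ C ⊆ W, IsOpen C ∧ Convex ℝ C ∧ latticeRect δ a b ⊆ C ∧ ∃ ψ, IsPrimitiveOn η C ψ := by
  obtain ⟨ε, hε, h'⟩ := (isCompact_latticeRect δ a b).exists_thickening_subset_open hW h
  exact ⟨_, h', isOpen_thickening, (convex_latticeRect δ a b).thickening ε,
    self_subset_thickening hε _, hη _ h' isOpen_thickening ((convex_latticeRect δ a b).thickening ε)⟩

/-- The floor may jump at `t`, but the closed interval selected by a nearby `s` still contains `t`.
This is what makes cell indices usable in continuity arguments. -/
lemma eventually_mem_floor_cell {δ : ℝ} (hδ : 0 < δ) (t : ℝ) :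
    ∀ᶠ s in 𝓝 t, δ * ⌊s / δ⌋ ≤ t ∧ t ≤ δ * (⌊s / δ⌋ + 1) := by
  have hc : Tendsto (fun s : ℝ ↦ s / δ) (𝓝 t) (𝓝 (t / δ)) := tendsto_id.div_const δ
  have h1 : ∀ᶠ s in 𝓝 t, s / δ < ⌊t / δ⌋ + 1 := hc.eventually_lt_const (Int.lt_floor_add_one _)
  have h2 : ∀ᶠ s in 𝓝 t, (⌈t / δ⌉ : ℝ) - 1 < s / δ :=
    hc.eventually_const_lt (by linarith [Int.ceil_lt_add_one (t / δ)])
  filter_upwards [h1, h2] with s h1 h2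
  have h1' : ⌊s / δ⌋ < ⌊t / δ⌋ + 1 := Int.floor_lt.2 (by exact_mod_cast h1)
  have h2' : ⌈t / δ⌉ - 1 ≤ ⌊s / δ⌋ := Int.le_floor.2 (by push_cast; exact h2.le)
  have h3 : (⌊s / δ⌋ : ℝ) ≤ t / δ :=
    le_trans (by exact_mod_cast (Int.lt_add_one_iff.1 h1')) (Int.floor_le _)
  have h4 : t / δ ≤ ⌊s / δ⌋ + 1 :=
    (Int.le_ceil _).trans (by exact_mod_cast (by lia : ⌈t / δ⌉ ≤ ⌊s / δ⌋ + 1))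
  rw [le_div_iff₀ hδ] at h3
  rw [div_le_iff₀ hδ] at h4
  constructor <;> linarith

/-- The lower left vertex of a lattice cell containing `x`. -/
def floorIndex (δ : ℝ) (x : Plane) : ℤ × ℤ := (⌊x 0 / δ⌋, ⌊x 1 / δ⌋)

lemma eventually_mem_cell {δ : ℝ} (hδ : 0 < δ) (x : Plane) :
    ∀ᶠ y in 𝓝 x, x ∈ cell δ (floorIndex δ y) := by
  filter_upwards [(continuous_coord 0).continuousAt.eventually (eventually_mem_floor_cell hδ (x 0)),
    (continuous_coord 1).continuousAt.eventually (eventually_mem_floor_cell hδ (x 1))] with y h0 h1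
  refine ⟨h0.1, ?_, h1.1, ?_⟩ <;> simp only [floorIndex] <;> push_cast
  exacts [h0.2, h1.2]

lemma mem_cell_floorIndex {δ : ℝ} (hδ : 0 < δ) (x : Plane) : x ∈ cell δ (floorIndex δ x) :=
  (eventually_mem_cell hδ x).self_of_nhds

lemma index_cases {δ t : ℝ} (hδ : 0 < δ) {i j : ℤ} (hi : δ * i ≤ t) (hi' : t ≤ δ * (i + 1))
    (hj : δ * j ≤ t) (hj' : t ≤ δ * (j + 1)) : i = j ∨ i = j + 1 ∨ j = i + 1 := by
  have h1 : (i : ℝ) ≤ j + 1 := le_of_mul_le_mul_left (hi.trans hj') hδ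
  have h2 : (j : ℝ) ≤ i + 1 := le_of_mul_le_mul_left (hj.trans hi') hδ
  have h1' : i ≤ j + 1 := by exact_mod_cast h1
  have h2' : j ≤ i + 1 := by exact_mod_cast h2
  lia

/-- Cells which contain points of a connected complement of `W` are linked by edges that are not
contained in `W`. -/
lemma mem_of_linked {δ : ℝ} (hδ : 0 < δ) (hW : IsPreconnected Wᶜ) {T : Set (ℤ × ℤ)}
    (hH : ∀ e ∈ cutHorizontal δ W, (e ∈ T ↔ (e.1, e.2 - 1) ∈ T))
    (hV : ∀ e ∈ cutVertical δ W, (e ∈ T ↔ (e.1 - 1, e.2) ∈ T))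
    {c₀ c : ℤ × ℤ} (h₀ : c₀ ∈ T) (hc₀ : ¬ cell δ c₀ ⊆ W) (hc : ¬ cell δ c ⊆ W) : c ∈ T := by
  -- A point outside `W` shared by two adjacent closed cells lies on their common edge, which is
  -- therefore cut.
  have stepV : ∀ x ∉ W, ∀ i j : ℤ, x ∈ cell δ (i, j) → x ∈ cell δ (i + 1, j) →
      ((i, j) ∈ T ↔ (i + 1, j) ∈ T) := by
    intro x hx i j h1 h2
    have : (i + 1, j) ∈ cutVertical δ W :=
      fun hsub ↦ hx (hsub ⟨h2.1, h1.2.1, h2.2.2.1, h2.2.2.2⟩)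
    simpa using (hV _ this).symm
  have stepH : ∀ x ∉ W, ∀ i j : ℤ, x ∈ cell δ (i, j) → x ∈ cell δ (i, j + 1) →
      ((i, j) ∈ T ↔ (i, j + 1) ∈ T) := by
    intro x hx i j h1 h2
    have : (i, j + 1) ∈ cutHorizontal δ W :=
      fun hsub ↦ hx (hsub ⟨h2.1, h2.2.1, h2.2.2.1, h1.2.2.2⟩)
    simpa using (hH _ this).symm
  have agree : ∀ x ∉ W, ∀ a b : ℤ × ℤ, x ∈ cell δ a → x ∈ cell δ b → (a ∈ T ↔ b ∈ T) := by
    rintro x hx ⟨i, j⟩ ⟨i', j'⟩ ha hb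
    -- Diagonal neighbours are compared through an intermediate cell that also contains `x`.
    have hm : x ∈ cell δ (i', j) := ⟨hb.1, hb.2.1, ha.2.2.1, ha.2.2.2⟩
    have h1 : (i, j) ∈ T ↔ (i', j) ∈ T := by
      have := index_cases hδ ha.1 (by simpa using ha.2.1) hb.1 (by simpa using hb.2.1)
      rcases this with h | h | h <;> dsimp only at h
      · rw [h]
      · subst h; exact (stepV x hx _ _ hm ha).symm
      · subst h; exact stepV x hx _ _ ha hm
    have h2 : (i', j) ∈ T ↔ (i', j') ∈ T := by
      have := index_cases hδ ha.2.2.1 (by simpa using ha.2.2.2) hb.2.2.1 (by simpa using hb.2.2.2)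
      rcases this with h | h | h <;> dsimp only at h
      · rw [h]
      · subst h; exact (stepH x hx _ _ hb hm).symm
      · subst h; exact stepH x hx _ _ hm hb
    exact h1.trans h2
  obtain ⟨x₀, hx₀, hx₀W⟩ := not_subset.1 hc₀
  obtain ⟨x, hx, hxW⟩ := not_subset.1 hc
  have main : floorIndex δ x₀ ∈ T ↔ floorIndex δ x ∈ T := by
    -- Membership of the floor index in `T` is locally constant along the connected set `Wᶜ`.
    refine hW.induction₂ (fun y z ↦ floorIndex δ y ∈ T ↔ floorIndex δ z ∈ T) (fun y hy ↦ ?_)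
      (fun y z w _ _ _ h h' ↦ h.trans h') (fun y z _ _ h ↦ h.symm) hx₀W hxW
    filter_upwards [nhdsWithin_le_nhds (eventually_mem_cell hδ y)] with z hz
    exact agree y hy _ _ (mem_cell_floorIndex hδ y) hz
  exact (agree x hxW _ _ hx (mem_cell_floorIndex hδ x)).2
    (main.1 ((agree x₀ hx₀W _ _ hx₀ (mem_cell_floorIndex hδ x₀)).1 h₀))

/-- The indicator of each cell that is not contained in the bounded set `W` is a boundary
relative to the edges contained in `W`. -/
lemma isRelCurl_single {δ : ℝ} (hδ : 0 < δ) (hW : IsPreconnected Wᶜ) (hWb : Bornology.IsBounded W)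
    {c : ℤ × ℤ} (hc : ¬ cell δ c ⊆ W) :
    IsRelCurl (cutHorizontal δ W) (cutVertical δ W) (Pi.single c 1) := by
  obtain ⟨R, hR⟩ := hWb.exists_norm_le
  obtain ⟨N, hN⟩ := exists_int_gt (R / δ)
  rw [div_lt_iff₀ hδ] at hN
  have far : ∀ x : Plane, δ * N ≤ x 1 → x ∉ W := fun x hx hxW ↦ by
    have := (le_abs_self _).trans ((abs_coord_le_norm x 1).trans (hR x hxW))
    linarith
  -- The starting cell `(0, N)` lies above `W`, so every edge higher in its column is cut and its
  -- indicator escapes to infinity.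
  refine mem_of_linked (T := {c | IsRelCurl (cutHorizontal δ W) (cutVertical δ W) (Pi.single c 1)})
    hδ hW (fun e he ↦ IsRelCurl.single_iff_of_mem_left he)
    (fun e he ↦ IsRelCurl.single_iff_of_mem_right he) (c₀ := (0, N)) ?_ ?_ hc
  · refine IsRelCurl.single_of_forall_above fun k hk hsub ↦ ?_
    refine far _ ?_ (hsub (vertex_mem_latticeRect hδ (c := (0, k)) le_rfl (by simp)))
    rw [vertex_one]
    gcongr
  · intro hsub
    exact far _ (by simp) (hsub (vertex_mem_latticeRect hδ (c := (0, N)) le_rfl (by simp)))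

/-- Potentials on the vertices of the lattice. -/
lemma IsLocallyExactOn.exists_vertex_potential (hη : IsLocallyExactOn η W) (hWo : IsOpen W)
    (hWb : Bornology.IsBounded W) (hW : IsPreconnected Wᶜ) {δ : ℝ} (hδ : 0 < δ)
    {I : Plane → Plane → ℝ} (hI : ∀ C ⊆ W, IsOpen C → Convex ℝ C → ∀ ψ, IsPrimitiveOn η C ψ →
      ∀ p ∈ C, ∀ q ∈ C, I p q = ψ q - ψ p) :
    ∃ m : ℤ × ℤ → ℝ, (∀ c ∉ cutHorizontal δ W,
      m (c.1 + 1, c.2) - m c = I (vertex δ c) (vertex δ (c.1 + 1, c.2))) ∧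
      ∀ c ∉ cutVertical δ W, m (c.1, c.2 + 1) - m c = I (vertex δ c) (vertex δ (c.1, c.2 + 1)) := by
  classical
  set h : ℤ × ℤ → ℝ := fun c ↦
    if c ∈ cutHorizontal δ W then 0 else I (vertex δ c) (vertex δ (c.1 + 1, c.2)) with hh
  set v : ℤ × ℤ → ℝ := fun c ↦
    if c ∈ cutVertical δ W then 0 else I (vertex δ c) (vertex δ (c.1, c.2 + 1)) with hv
  have hzero : ∀ c, cell δ c ⊆ W → curl h v c = 0 := by
    rintro ⟨i, j⟩ hc
    obtain ⟨C, hCW, hCo, hCc, hcC, ψ, hψ⟩ := hη.exists_primitive_near_latticeRect hWo hc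
    have sub : ∀ a b : ℤ × ℤ, (i, j) ≤ a → b ≤ (i + 1, j + 1) → latticeRect δ a b ⊆ W := by
      intro a b ha hb x hx
      refine hc ⟨le_trans ?_ hx.1, hx.2.1.trans ?_, le_trans ?_ hx.2.2.1, hx.2.2.2.trans ?_⟩ <;>
        gcongr
      exacts [ha.1, hb.1, ha.2, hb.2]
    have mem : ∀ a : ℤ × ℤ, (i, j) ≤ a → a ≤ (i + 1, j + 1) → vertex δ a ∈ C :=
      fun a h1 h2 ↦ hcC (vertex_mem_latticeRect hδ h1 h2)
    have val : ∀ a b : ℤ × ℤ, (i, j) ≤ a → a ≤ (i + 1, j + 1) → (i, j) ≤ b → b ≤ (i + 1, j + 1) →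
        I (vertex δ a) (vertex δ b) = ψ (vertex δ b) - ψ (vertex δ a) :=
      fun a b h1 h2 h3 h4 ↦ hI C hCW hCo hCc ψ hψ _ (mem a h1 h2) _ (mem b h3 h4)
    simp only [curl, hh, hv]
    rw [if_neg, if_neg, if_neg, if_neg, val, val, val, val]
    · ring
    all_goals first
      | (simp only [cutHorizontal, cutVertical, mem_ofPred_eq, not_not]; apply sub <;> simp)
      | simp
  obtain ⟨R, hR⟩ := hWb.exists_norm_le
  obtain ⟨N, hN⟩ := exists_nat_gt (R / δ)
  rw [div_lt_iff₀ hδ] at hN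
  have small : ∀ c : ℤ × ℤ, vertex δ c ∈ W → -N ≤ c.1 ∧ c.1 ≤ N ∧ -N ≤ c.2 ∧ c.2 ≤ N := by
    intro c hc
    have key : ∀ k : ℤ, |δ * k| ≤ R → -N ≤ k ∧ k ≤ N := by
      intro k hk
      rw [abs_mul, abs_of_pos hδ] at hk
      have : |(k : ℝ)| < N := lt_of_mul_lt_mul_left (by linarith) hδ.le
      have : |k| < N := by exact_mod_cast this
      exact ⟨by linarith [abs_lt.1 this], (abs_lt.1 this).2.le⟩
    have h0 := key c.1 ((abs_coord_le_norm (vertex δ c) 0).trans (hR _ hc))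
    have h1 := key c.2 ((abs_coord_le_norm (vertex δ c) 1).trans (hR _ hc))
    exact ⟨h0.1, h0.2, h1.1, h1.2⟩
  have hfin : {c | curl h v c ≠ 0}.Finite := by
    -- A cell is indexed by its lower left vertex, which may precede a vertex in `W` by one: hence
    -- `-N - 1`. Cells with no vertex in `W` have all four edges cut, so zero circulation.
    refine (finite_Icc ((-N - 1, -N - 1) : ℤ × ℤ) (N, N)).subset fun c hc ↦ ?_
    by_contra hcon
    have hout : ∀ a : ℤ × ℤ, c ≤ a → a ≤ (c.1 + 1, c.2 + 1) → vertex δ a ∉ W := by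
      intro a h1 h2 ha
      have := small a ha
      have h3 := h1.1
      have h4 := h1.2
      have h5 := h2.1
      have h6 := h2.2
      dsimp only at h5 h6
      refine hcon ⟨⟨?_, ?_⟩, ?_, ?_⟩ <;> dsimp only <;> lia
    refine hc ?_
    simp only [curl, hh, hv]
    rw [if_pos, if_pos, if_pos, if_pos]
    · ring
    · exact fun hsub ↦ hout c le_rfl (by simp [Prod.le_def])
        (hsub (vertex_mem_latticeRect hδ le_rfl (by simp [Prod.le_def])))
    · exact fun hsub ↦ hout (c.1, c.2 + 1) (by simp [Prod.le_def]) (by simp [Prod.le_def])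
        (hsub (vertex_mem_latticeRect hδ le_rfl (by simp [Prod.le_def])))
    · exact fun hsub ↦ hout (c.1 + 1, c.2) (by simp [Prod.le_def]) (by simp [Prod.le_def])
        (hsub (vertex_mem_latticeRect hδ le_rfl (by simp [Prod.le_def])))
    · exact fun hsub ↦ hout c le_rfl (by simp [Prod.le_def])
        (hsub (vertex_mem_latticeRect hδ le_rfl (by simp [Prod.le_def])))
  obtain ⟨m, hm1, hm2⟩ := IsRelCurl.exists_potential hfin fun c hc ↦
    isRelCurl_single hδ hW hWb fun hsub ↦ hc (hzero c hsub)
  refine ⟨m, fun c hc ↦ ?_, fun c hc ↦ ?_⟩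
  · rw [hm1 c hc, hh]; exact if_neg hc
  · rw [hm2 c hc, hv]; exact if_neg hc

lemma latticeRect_subset_of_norm {δ : ℝ} (hδ : 0 < δ) {a b : ℤ × ℤ} {x : Plane} {r : ℝ}
    (h : ∀ i j : ℝ, a.1 ≤ i → i ≤ b.1 → a.2 ≤ j → j ≤ b.2 → |δ * i - x 0| + |δ * j - x 1| < r) :
    latticeRect δ a b ⊆ ball x r := by
  intro y hy
  rw [mem_ball, dist_eq_norm]
  refine (norm_le_abs_add_abs _).trans_lt ?_
  have := h (y 0 / δ) (y 1 / δ) ((le_div_iff₀' hδ).2 hy.1) ((div_le_iff₀' hδ).2 hy.2.1)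
    ((le_div_iff₀' hδ).2 hy.2.2.1) ((div_le_iff₀' hδ).2 hy.2.2.2)
  rwa [mul_div_cancel₀ _ hδ.ne', mul_div_cancel₀ _ hδ.ne'] at this

/-- On a bounded open set with connected complement, a locally exact form has a primitive away
from any neighbourhood of the boundary. -/
lemma IsLocallyExactOn.exists_primitive_inside (hη : IsLocallyExactOn η W) (hWo : IsOpen W)
    (hWb : Bornology.IsBounded W) (hW : IsPreconnected Wᶜ) {δ : ℝ} (hδ : 0 < δ) :
    ∃ φ : Plane → ℝ, IsPrimitiveOn η {x | ball x (8 * δ) ⊆ W} φ := by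
  obtain ⟨I, hI⟩ := IsLocallyExactOn.exists_integral η W
  obtain ⟨m, hm1, hm2⟩ := hη.exists_vertex_potential hWo hWb hW hδ hI
  refine ⟨fun y ↦ m (floorIndex δ y) + I (vertex δ (floorIndex δ y)) y, fun x hx ↦ ?_⟩
  obtain ⟨Ψ, hΨ⟩ := hη _ hx isOpen_ball (convex_ball x (8 * δ))
  have hIB := hI _ hx isOpen_ball (convex_ball x (8 * δ)) Ψ hΨ
  -- `D` compares the lattice potential with a local primitive. It is constant on the 3 × 3 block of
  -- vertices around `k`, whose edges all lie in the ball; hence the glued function is `Ψ` plus a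
  -- constant near `x`.
  set D : ℤ × ℤ → ℝ := fun c ↦ m c - Ψ (vertex δ c) with hD
  have hfl : ∀ t : ℝ, δ * ⌊t / δ⌋ ≤ t ∧ t < δ * (⌊t / δ⌋ + 1) := fun t ↦
    ⟨(le_div_iff₀' hδ).1 (Int.floor_le _), (div_lt_iff₀' hδ).1 (Int.lt_floor_add_one _)⟩
  obtain ⟨h00, h01⟩ := hfl (x 0)
  obtain ⟨h10, h11⟩ := hfl (x 1)
  set k : ℤ × ℤ := floorIndex δ x with hk
  have near : ∀ a b : ℤ × ℤ, k - (1, 1) ≤ a → b ≤ k + (1, 1) →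
      latticeRect δ a b ⊆ ball x (8 * δ) := by
    rintro a b ⟨ha1, ha2⟩ ⟨hb1, hb2⟩
    have ha1' : ((k.1 : ℝ) - 1) ≤ a.1 := by exact_mod_cast ha1
    have ha2' : ((k.2 : ℝ) - 1) ≤ a.2 := by exact_mod_cast ha2
    have hb1' : (b.1 : ℝ) ≤ k.1 + 1 := by exact_mod_cast hb1
    have hb2' : (b.2 : ℝ) ≤ k.2 + 1 := by exact_mod_cast hb2
    refine latticeRect_subset_of_norm hδ fun i j hi hi' hj hj' ↦ ?_
    have e1 : δ * (k.1 - 1) ≤ δ * i := by gcongr; linarith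
    have e2 : δ * i ≤ δ * (k.1 + 1) := by gcongr; linarith
    have e3 : δ * (k.2 - 1) ≤ δ * j := by gcongr; linarith
    have e4 : δ * j ≤ δ * (k.2 + 1) := by gcongr; linarith
    have e5 : |δ * i - x 0| ≤ 2 * δ := by
      simp only [hk, floorIndex] at e1 e2
      rw [abs_le]
      constructor <;> nlinarith
    have e6 : |δ * j - x 1| ≤ 2 * δ := by
      simp only [hk, floorIndex] at e3 e4
      rw [abs_le]
      constructor <;> nlinarith
    linarith
  have memB : ∀ a : ℤ × ℤ, k - (1, 1) ≤ a → a ≤ k + (1, 1) → vertex δ a ∈ ball x (8 * δ) :=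
    fun a h h' ↦ near a a h h' (vertex_mem_latticeRect hδ le_rfl le_rfl)
  have stepH : ∀ i j : ℤ, k - (1, 1) ≤ (i, j) → (i + 1, j) ≤ k + (1, 1) →
      D (i + 1, j) = D (i, j) := by
    intro i j h h'
    have h1 := hm1 (i, j) (not_not.2 ((near _ _ h h').trans hx))
    rw [hIB _ (memB _ h (le_trans (by simp) h')) _ (memB _ (h.trans (by simp)) h')] at h1
    simp only [hD] at h1 ⊢
    linarith
  have stepV : ∀ i j : ℤ, k - (1, 1) ≤ (i, j) → (i, j + 1) ≤ k + (1, 1) →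
      D (i, j + 1) = D (i, j) := by
    intro i j h h'
    have h1 := hm2 (i, j) (not_not.2 ((near _ _ h h').trans hx))
    rw [hIB _ (memB _ h (le_trans (by simp) h')) _ (memB _ (h.trans (by simp)) h')] at h1
    simp only [hD] at h1 ⊢
    linarith
  have hDk : ∀ c : ℤ × ℤ, k - (1, 1) ≤ c → c ≤ k + (1, 1) → D c = D k := by
    rintro ⟨i, j⟩ h h'
    obtain ⟨a, b⟩ := k
    simp only [Prod.le_def, Prod.fst_sub, Prod.snd_sub, Prod.fst_add, Prod.snd_add] at *
    have r1 : D (i, j) = D (a, j) := by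
      rcases (by lia : i = a ∨ i = a + 1 ∨ a = i + 1) with e | e | e
      · rw [e]
      · subst e; exact stepH _ _ ⟨by lia, by lia⟩ ⟨by lia, by lia⟩
      · subst e; exact (stepH _ _ ⟨by lia, by lia⟩ ⟨by lia, by lia⟩).symm
    have r2 : D (a, j) = D (a, b) := by
      rcases (by lia : j = b ∨ j = b + 1 ∨ b = j + 1) with e | e | e
      · rw [e]
      · subst e; exact stepV _ _ ⟨by lia, by lia⟩ ⟨by lia, by lia⟩
      · subst e; exact (stepV _ _ ⟨by lia, by lia⟩ ⟨by lia, by lia⟩).symm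
    exact r1.trans r2
  have hball : ball x (8 * δ) ∈ 𝓝 x := ball_mem_nhds x (by positivity)
  have hev : (fun y ↦ m (floorIndex δ y) + I (vertex δ (floorIndex δ y)) y) =ᶠ[𝓝 x]
      fun y ↦ Ψ y + D k := by
    filter_upwards [hball, eventually_mem_cell hδ x] with y hy hxy
    have hxk := mem_cell_floorIndex hδ x
    have c1 := index_cases hδ hxk.1 (by simpa using hxk.2.1) hxy.1 (by simpa using hxy.2.1)
    have c2 := index_cases hδ hxk.2.2.1 (by simpa using hxk.2.2.2) hxy.2.2.1
      (by simpa using hxy.2.2.2)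
    rw [← hk] at c1 c2
    have b1 : k - (1, 1) ≤ floorIndex δ y := ⟨by simp; lia, by simp; lia⟩
    have b2 : floorIndex δ y ≤ k + (1, 1) := ⟨by simp; lia, by simp; lia⟩
    rw [hIB _ (memB _ b1 b2) y hy, ← hDk _ b1 b2]
    simp only [hD]
    ring
  exact ((hΨ x (mem_of_mem_nhds hball)).add_const _).congr_of_eventuallyEq hev

/-- Two primitives differ by a constant on preconnected sets. -/
lemma IsPrimitiveOn.sub_eq_sub_of_isPreconnected {ψ ψ' : Plane → ℝ} {K : Set Plane} {r : ℝ}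
    (hr : 0 < r) (h : IsPrimitiveOn η (thickening r K) ψ) (h' : IsPrimitiveOn η (thickening r K) ψ')
    (hK : IsPreconnected K) {p q : Plane} (hp : p ∈ K) (hq : q ∈ K) :
    ψ q - ψ p = ψ' q - ψ' p := by
  have := hK.induction₂ (fun y z ↦ ψ z - ψ y = ψ' z - ψ' y) (fun y hy ↦ ?_)
    (fun _ _ _ _ _ _ h h' ↦ by linarith) (fun _ _ _ _ h ↦ by linarith) hp hq
  · exact this
  · refine nhdsWithin_le_nhds ?_
    filter_upwards [ball_mem_nhds y hr] with z hz
    have hsub := ball_subset_thickening hy r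
    exact IsPrimitiveOn.sub_eq_sub (fun x hx ↦ h x (hsub hx)) (fun x hx ↦ h' x (hsub hx))
      (convex_ball y r) (mem_ball_self hr) hz

/-- A locally exact form is exact on bounded open sets with connected complement. -/
theorem IsLocallyExactOn.exists_primitive (hη : IsLocallyExactOn η W) (hWo : IsOpen W)
    (hWb : Bornology.IsBounded W) (hW : IsPreconnected Wᶜ) : ∃ φ, IsPrimitiveOn η W φ := by
  have hδ : ∀ k : ℕ, (0 : ℝ) < 1 / ((k : ℝ) + 1) := fun k ↦ Nat.one_div_pos_of_nat
  choose φ hφ using fun k : ℕ ↦ hη.exists_primitive_inside hWo hWb hW (hδ k)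
  have hφK : ∀ K ⊆ W, IsCompact K → ∃ r > 0, ∃ N : ℕ, ∀ k ≥ N,
      IsPrimitiveOn η (thickening r K) (φ k) := by
    intro K hKW hK
    obtain ⟨r, hr, hrW⟩ := hK.exists_thickening_subset_open hWo hKW
    -- With mesh below `r / 16`, a ball of radius eight meshes about a point within `r / 2` of `K`
    -- stays in the `r`-thickening.
    obtain ⟨N, hN⟩ := exists_nat_one_div_lt (show 0 < r / 16 by positivity)
    refine ⟨r / 2, by positivity, N, fun k hk x hx ↦ hφ k x ?_⟩
    refine Subset.trans (fun y hy ↦ ?_) hrW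
    have h1 := Nat.one_div_le_one_div (α := ℝ) hk
    obtain ⟨z, hz, hxz⟩ := mem_thickening_iff.1 hx
    refine mem_thickening_iff.2 ⟨z, hz, ?_⟩
    have := dist_triangle y x z
    rw [mem_ball] at hy
    linarith
  -- The base point is chosen from the component as a set, so all points of a component share it.
  -- Subtracting the value there removes the free constants of the `φ k`.
  set b : Plane → Plane := fun x ↦ Classical.epsilon (· ∈ connectedComponentIn W x) with hb
  have key : ∀ x ∈ W, ∃ U ∈ 𝓝 x, ∃ N : ℕ, ∀ k ≥ N, ∀ y ∈ U,
      φ k y - φ k (b y) = φ N y - φ N (b x) ∧ HasFDerivAt (φ N) (η x) x := by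
    intro x hx
    obtain ⟨r, hr, hrW⟩ := Metric.isOpen_iff.1 hWo x hx
    have hbx : b x ∈ connectedComponentIn W x :=
      Classical.epsilon_spec (p := (· ∈ connectedComponentIn W x)) ⟨x, mem_connectedComponentIn hx⟩
    have hpc : IsPathConnected (connectedComponentIn W x) :=
      (hWo.connectedComponentIn.isConnected_iff_isPathConnected).1
        (isConnected_connectedComponentIn_iff.2 hx)
    obtain ⟨γ, hγ⟩ := hpc.joinedIn x (mem_connectedComponentIn hx) (b x) hbx
    set K := range γ ∪ closedBall x (r / 2) with hKdef
    have hBW : closedBall x (r / 2) ⊆ W := (closedBall_subset_ball (by linarith)).trans hrW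
    have hKW : K ⊆ W := union_subset
      (range_subset_iff.2 fun t ↦ connectedComponentIn_subset _ _ (hγ t)) hBW
    have hK : IsCompact K := (isCompact_range γ.continuous).union (isCompact_closedBall _ _)
    have hxB : x ∈ closedBall x (r / 2) := mem_closedBall_self (by positivity)
    -- `K`, a path to the base point together with a ball, is compact and connected: for large `k`
    -- all `φ k` have the same increments on it, so the normalized values are eventually constant.
    have hKp : IsPreconnected K := (isPreconnected_range γ.continuous).union x
      ⟨0, γ.source⟩ hxB (convex_closedBall x (r / 2)).isPreconnected
    obtain ⟨ρ, hρ, N, hN⟩ := hφK K hKW hK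
    refine ⟨closedBall x (r / 2), closedBall_mem_nhds x (by positivity), N, fun k hk y hy ↦ ⟨?_, ?_⟩⟩
    · have hby : b y = b x := by
        have : connectedComponentIn W x = connectedComponentIn W y :=
          connectedComponentIn_eq <|
            (convex_closedBall x (r / 2)).isPreconnected.subset_connectedComponentIn hxB hBW hy
        simp only [hb, this]
      rw [hby]
      exact IsPrimitiveOn.sub_eq_sub_of_isPreconnected hρ (hN k hk) (hN N le_rfl) hKp
        (Or.inl ⟨1, γ.target⟩) (Or.inr hy)
    · exact hN N le_rfl x (self_subset_thickening hρ _ (Or.inr hxB))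
  have lim : ∀ x, ∃ c, x ∈ W → ∃ N : ℕ, ∀ k ≥ N, φ k x - φ k (b x) = c := by
    intro x
    by_cases hx : x ∈ W
    · obtain ⟨U, hU, N, hN⟩ := key x hx
      exact ⟨_, fun _ ↦ ⟨N, fun k hk ↦ (hN k hk x (mem_of_mem_nhds hU)).1⟩⟩
    · exact ⟨0, fun h ↦ (hx h).elim⟩
  choose Φ hΦ using lim
  refine ⟨Φ, fun x hx ↦ ?_⟩
  obtain ⟨U, hU, N, hN⟩ := key x hx
  have hev : Φ =ᶠ[𝓝 x] fun y ↦ φ N y - φ N (b x) := by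
    filter_upwards [hU, hWo.mem_nhds hx] with y hy hyW
    obtain ⟨M, hM⟩ := hΦ y hyW
    rw [← hM (max M N) (le_max_left _ _), (hN (max M N) (le_max_right _ _) y hy).1]
  exact ((hN N le_rfl x (mem_of_mem_nhds hU)).2.sub_const _).congr_of_eventuallyEq hev

/-! ### Closed potentials on pieces of the domain without holes -/

/-- The identification of alternating `1`-forms with linear forms. -/
def altToDual : (Plane [⋀^Fin 1]→L[ℝ] ℝ) →L[ℝ] Plane →L[ℝ] ℝ :=
  (ContinuousAlternatingMap.ofSubsingletonLIE (𝕜 := ℝ) (E := Plane) (F := ℝ)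
    (0 : Fin 1)).symm.toContinuousLinearEquiv.toContinuousLinearMap

lemma altToDual_apply (B : Plane [⋀^Fin 1]→L[ℝ] ℝ) (v : Plane) : altToDual B v = B ![v] := by
  rw [Matrix.vec_single_eq_const]; rfl

/-- The `1`-form `A` as a function with values in the dual of the plane. -/
def OneForm.toDual (A : OneForm) (x : Plane) : Plane →L[ℝ] ℝ := altToDual (A x)

lemma OneForm.toDual_apply (A : OneForm) (x v : Plane) : A.toDual x v = A x ![v] :=
  altToDual_apply _ _

lemma OneForm.toDual_e (A : OneForm) (j : Fin 2) (x : Plane) : A.toDual x (e j) = A.coeff j x :=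
  A.toDual_apply x (e j)

/-- Evaluated on `![u, v]`, `dA = 0` is the symmetry of the derivative of `A.toDual`; the Poincaré
lemma on convex open sets applies. -/
lemma IsClosedPotential.isLocallyExactOn {Ω : Set Plane} {A : OneForm}
    (hA : IsClosedPotential Ω A) (hΩ : IsOpen Ω) : IsLocallyExactOn A.toDual Ω := by
  intro C hC hCo hCc
  have hdA : ∀ x ∈ C, DifferentiableAt ℝ A x := fun x hx ↦
    ((hA.smooth.mono subset_closure).contDiffAt (hΩ.mem_nhds (hC hx))).differentiableAt (by simp)
  have hd : ∀ x ∈ C, HasFDerivAt A.toDual (altToDual ∘L fderiv ℝ A x) x := fun x hx ↦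
    altToDual.hasFDerivAt.comp x (hdA x hx).hasFDerivAt
  refine hCc.exists_forall_hasFDerivAt_of_fderiv_symmetric hCo
    (fun x hx ↦ (hd x hx).differentiableAt.differentiableWithinAt) fun x hx u v ↦ ?_
  rw [(hd x hx).fderiv]
  simp only [ContinuousLinearMap.comp_apply, altToDual_apply]
  have h := congrArg (fun B ↦ B ![u, v]) (hA.closed x (hC hx))
  simp only [extDeriv, ContinuousAlternatingMap.alternatizeUncurryFin_apply] at h
  have h0 : Fin.removeNth 0 ![u, v] = ![v] := by ext i; fin_cases i; rfl
  have h1 : Fin.removeNth 1 ![u, v] = ![u] := by ext i; fin_cases i; rfl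
  simp [h0, h1] at h
  linarith

/-- The open rectangle with lower left vertex `a` and upper right vertex `b`. -/
def openRect (a b : Plane) : Set Plane := {x | a 0 < x 0 ∧ x 0 < b 0 ∧ a 1 < x 1 ∧ x 1 < b 1}

lemma isOpen_openRect (a b : Plane) : IsOpen (openRect a b) :=
  (isOpen_lt continuous_const (continuous_coord 0)).inter <|
    (isOpen_lt (continuous_coord 0) continuous_const).inter <|
      (isOpen_lt continuous_const (continuous_coord 1)).inter <|
        isOpen_lt (continuous_coord 1) continuous_const

lemma isBounded_openRect (a b : Plane) : Bornology.IsBounded (openRect a b) := by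
  refine isBounded_iff_forall_norm_le.2
    ⟨max |a 0| |b 0| + max |a 1| |b 1|, fun x hx ↦ ?_⟩
  exact (norm_le_abs_add_abs x).trans (add_le_add (abs_le_max_abs_abs hx.1.le hx.2.1.le)
    (abs_le_max_abs_abs hx.2.2.1.le hx.2.2.2.le))

/-- The complement is a union of four half-planes, chained together through corner points. -/
lemma isPreconnected_compl_openRect (a b : Plane) : IsPreconnected (openRect a b)ᶜ := by
  have h : (openRect a b)ᶜ =
      (({x | x 0 ≤ a 0} ∪ {x | x 1 ≤ a 1}) ∪ {x | b 0 ≤ x 0}) ∪ {x | b 1 ≤ x 1} := by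
    ext x
    simp only [openRect, mem_compl_iff, mem_ofPred_eq, not_and_or, not_lt, mem_union]
    tauto
  rw [h]
  have le (j : Fin 2) (r : ℝ) : IsPreconnected {x : Plane | x j ≤ r} :=
    (convex_halfSpace_le (isLinearMap_coord j) r).isPreconnected
  have ge (j : Fin 2) (r : ℝ) : IsPreconnected {x : Plane | r ≤ x j} :=
    (convex_halfSpace_ge (isLinearMap_coord j) r).isPreconnected
  refine (((le 0 _).union !₂[a 0, a 1] ?_ ?_ (le 1 _)).union !₂[b 0, a 1] ?_ ?_ (ge 0 _)).union
    !₂[a 0, b 1] ?_ ?_ (ge 1 _) <;> simp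

/-- Cutting a bounded set by a rectangle which contains no hole of it yields a set with connected
complement. -/
lemma isPreconnected_compl_inter_openRect {Ω P : Set Plane} {a b : Plane}
    (hP : ∀ K ∈ holes Ω, (K ∩ P).Nonempty) (hab : Disjoint (openRect a b) P) :
    IsPreconnected (Ω ∩ openRect a b)ᶜ := by
  have hQ := isPreconnected_compl_openRect a b
  -- Every component of `Ωᶜ` leaves the rectangle: a bounded one is a hole and contains a point of
  -- `P`, an unbounded one does not fit. Each is thus attached to the connected exterior of the
  -- rectangle.
  have hmeet : ∀ x ∈ Ωᶜ, (connectedComponentIn Ωᶜ x ∩ (openRect a b)ᶜ).Nonempty := by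
    intro x hx
    by_cases hb : Bornology.IsBounded (connectedComponentIn Ωᶜ x)
    · obtain ⟨p, hp, hpP⟩ := hP _ ⟨hb, x, hx, rfl⟩
      exact ⟨p, hp, fun h ↦ disjoint_left.1 hab h hpP⟩
    · by_contra h
      rw [not_nonempty_iff_eq_empty, ← sdiff_eq, sdiff_eq_empty] at h
      exact hb ((isBounded_openRect a b).subset h)
  have hne : ((openRect a b)ᶜ).Nonempty := ⟨a, fun h ↦ lt_irrefl _ h.1⟩
  obtain ⟨o, ho⟩ := hne
  refine isPreconnected_of_forall o fun y hy ↦ ?_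
  rw [compl_inter] at hy ⊢
  by_cases hyΩ : y ∈ Ωᶜ
  · exact ⟨connectedComponentIn Ωᶜ y ∪ (openRect a b)ᶜ,
      union_subset_union_left _ (connectedComponentIn_subset _ _), Or.inr ho,
      Or.inl (mem_connectedComponentIn hyΩ),
      isPreconnected_connectedComponentIn.union' (hmeet y hyΩ) hQ⟩
  · exact ⟨_, subset_union_right, ho, hy.resolve_left hyΩ, hQ⟩

/-- A closed potential is exact on the part of the domain in a rectangle which contains no hole. -/
theorem IsClosedPotential.exists_primitive {Ω P : Set Plane} {A : OneForm} {a b : Plane}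
    (hA : IsClosedPotential Ω A) (hΩ : IsOpen Ω)
    (hP : ∀ K ∈ holes Ω, (K ∩ P).Nonempty) (hab : Disjoint (openRect a b) P) :
    ∃ φ, IsPrimitiveOn A.toDual (Ω ∩ openRect a b) φ :=
  IsLocallyExactOn.exists_primitive
    (fun C hC ↦ hA.isLocallyExactOn hΩ C (hC.trans inter_subset_left))
    (hΩ.inter (isOpen_openRect a b)) ((isBounded_openRect a b).subset inter_subset_right)
    (isPreconnected_compl_inter_openRect hP hab)

/-! ### Differentiable test functions -/

lemma norm_e (j : Fin 2) : ‖e j‖ = 1 := by simp [e]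

/-- A bounded differentiable function with bounded gradient on a bounded open set is in `H¹`. -/
lemma isH1WithGradient_of_differentiableAt {Ω : Set Plane} (hΩ : IsOpen Ω)
    (hb : Bornology.IsBounded Ω) {u : Plane → ℂ} (hu : ∀ x ∈ Ω, DifferentiableAt ℝ u x)
    {B : ℝ} (hB : ∀ x ∈ Ω, ‖u x‖ ≤ B) {B' : ℝ} (hB' : ∀ x ∈ Ω, ‖fderiv ℝ u x‖ ≤ B') :
    IsH1WithGradient Ω u fun j x ↦ fderiv ℝ u x (e j) := by
  have hfin : IsFiniteMeasure (volume.restrict Ω) :=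
    isFiniteMeasure_restrict.2 hb.measure_lt_top.ne
  have hum : AEStronglyMeasurable u (volume.restrict Ω) :=
    ContinuousOn.aestronglyMeasurable
      (fun x hx ↦ (hu x hx).continuousAt.continuousWithinAt) hΩ.measurableSet
  have hgm (j : Fin 2) : AEStronglyMeasurable (fun x ↦ fderiv ℝ u x (e j)) (volume.restrict Ω) :=
    (measurable_fderiv_apply_const ℝ u (e j)).aestronglyMeasurable
  have hg (j : Fin 2) : ∀ x ∈ Ω, ‖fderiv ℝ u x (e j)‖ ≤ B' := fun x hx ↦ by
    simpa [norm_e] using ((fderiv ℝ u x).le_of_opNorm_le (hB' x hx) (e j))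
  refine ⟨MemLp.of_bound hum B ((ae_restrict_iff' hΩ.measurableSet).2 (ae_of_all _ hB)),
    fun j ↦ MemLp.of_bound (hgm j) B' ((ae_restrict_iff' hΩ.measurableSet).2 (ae_of_all _ (hg j))),
    fun j φ hφ hφc hφΩ ↦ ?_⟩
  have hd (x : Plane) : HasFDerivAt (fun y ↦ (φ y : ℂ)) (Complex.ofRealCLM ∘L fderiv ℝ φ x) x :=
    Complex.ofRealCLM.hasFDerivAt.comp x (hφ.differentiable (by simp) x).hasFDerivAt
  have hφ0 : ∀ x ∉ Ω, φ x = 0 := fun x hx ↦ image_eq_zero_of_notMem_tsupport fun h ↦ hx (hφΩ h)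
  have hdφ0 : ∀ x ∉ Ω, fderiv ℝ φ x = 0 := fun x hx ↦
    image_eq_zero_of_notMem_tsupport fun h ↦ hx (hφΩ (tsupport_fderiv_subset ℝ h))
  have hdc : Continuous fun x ↦ fderiv ℝ φ x (e j) :=
    (hφ.continuous_fderiv (by simp)).clm_apply continuous_const
  obtain ⟨M, hM⟩ := hφc.exists_bound_of_continuous hφ.continuous
  obtain ⟨M', hM'⟩ := (hφc.fderiv ℝ).exists_bound_of_continuous (hφ.continuous_fderiv (by simp))
  -- Products with the test function vanish off `Ω`, hence are integrable on the whole plane.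
  -- Integration by parts there needs `u` differentiable only on the support of `φ`.
  have integ : ∀ (g h : Plane → ℂ) (a b : ℝ), AEStronglyMeasurable g (volume.restrict Ω) →
      Continuous h → (∀ x ∈ Ω, ‖g x‖ ≤ a) → (∀ x, ‖h x‖ ≤ b) → (∀ x ∉ Ω, h x = 0) →
      Integrable (fun x ↦ g x * h x) := by
    intro g h a b hgm hhc hga hhb hh0
    rw [← integrableOn_iff_integrable_of_support_subset (s := Ω)]
    · refine Integrable.of_bound (hgm.mul hhc.aestronglyMeasurable) (a * b)
        ((ae_restrict_iff' hΩ.measurableSet).2 (ae_of_all _ fun x hx ↦ ?_))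
      rw [norm_mul]
      exact mul_le_mul (hga x hx) (hhb x) (norm_nonneg _) ((norm_nonneg _).trans (hga x hx))
    · intro x hx
      by_contra hxΩ
      exact hx (by simp [hh0 x hxΩ])
  have hdval : ∀ x, fderiv ℝ (fun y ↦ (φ y : ℂ)) x (e j) = (fderiv ℝ φ x (e j) : ℂ) := fun x ↦ by
    rw [(hd x).fderiv]; simp
  have key := integral_mul_fderiv_eq_neg_fderiv_mul_of_integrable (μ := (volume : Measure Plane))
    (f := u) (g := fun x ↦ (φ x : ℂ)) (v := e j)
    (integ _ _ B' M (hgm j) (Complex.continuous_ofReal.comp hφ.continuous) (hg j)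
      (fun x ↦ by simpa using hM x) (fun x hx ↦ by simp [hφ0 x hx]))
    (by
      simp only [hdval]
      exact integ _ _ B M' hum (Complex.continuous_ofReal.comp hdc) hB
        (fun x ↦ by simpa [norm_e] using (fderiv ℝ φ x).le_of_opNorm_le (hM' x) (e j))
        (fun x hx ↦ by simp [hdφ0 x hx]))
    (integ _ _ B M hum (Complex.continuous_ofReal.comp hφ.continuous) hB
      (fun x ↦ by simpa using hM x) (fun x hx ↦ by simp [hφ0 x hx]))
    (fun x hx ↦ hu x (hφΩ (tsupport_comp_subset Complex.ofReal_zero φ hx)))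
    (fun x _ ↦ (hd x).differentiableAt)
  simp only [hdval] at key
  rwa [setIntegral_eq_integral_of_forall_compl_eq_zero fun x hx ↦ by simp [hdφ0 x hx],
    setIntegral_eq_integral_of_forall_compl_eq_zero fun x hx ↦ by simp [hφ0 x hx]]

/-! ### The Rayleigh quotient -/

lemma rayleighQuotients_nonneg {Ω : Set Plane} {A : OneForm} {R : ℝ}
    (hR : R ∈ rayleighQuotients Ω A) : 0 ≤ R := by
  obtain ⟨u, G, -, -, rfl⟩ := hR
  exact div_nonneg (integral_nonneg fun x ↦ by positivity) (integral_nonneg fun x ↦ by positivity)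

lemma lambda1_nonneg (Ω : Set Plane) (A : OneForm) : 0 ≤ lambda1 Ω A :=
  Real.sInf_nonneg fun _ ↦ rayleighQuotients_nonneg

/-- The product form also covers `u = 0`, so test functions need not be shown nonzero, and it can be
summed over the grids. -/
lemma lambda1_mul_le {Ω : Set Plane} {A : OneForm} {u : Plane → ℂ} {G : Fin 2 → Plane → ℂ}
    (hu : IsH1WithGradient Ω u G) :
    lambda1 Ω A * ∫ x in Ω, ‖u x‖ ^ 2 ≤ magneticEnergy Ω A u G := by
  by_cases h0 : u =ᵐ[volume.restrict Ω] 0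
  · have : ∫ x in Ω, ‖u x‖ ^ 2 = 0 :=
      integral_eq_zero_of_ae (h0.mono fun x hx ↦ by simp [hx])
    rw [this, mul_zero]
    exact integral_nonneg fun x ↦ by positivity
  · have hpos : 0 < ∫ x in Ω, ‖u x‖ ^ 2 := by
      refine lt_of_le_of_ne (integral_nonneg fun x ↦ by positivity) fun h ↦ h0 ?_
      have hi : Integrable (fun x ↦ ‖u x‖ ^ 2) (volume.restrict Ω) := hu.memLp.integrable_norm_pow two_ne_zero
      filter_upwards [(integral_eq_zero_iff_of_nonneg (fun x ↦ by positivity) hi).1 h.symm]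
        with x hx
      simpa using hx
    rw [← le_div_iff₀ hpos]
    exact csInf_le ⟨0, fun _ ↦ rayleighQuotients_nonneg⟩ ⟨u, G, hu, h0, rfl⟩

/-! ### The cutoff functions of a square grid -/

/-- A `C¹` profile which vanishes to second order at the integers. -/
def profile (t : ℝ) : ℝ := Real.sin (Real.pi * t - Real.sin (4 * Real.pi * t) / 4)

/-- The derivative of `profile`. -/
def profileDeriv (t : ℝ) : ℝ :=
  Real.cos (Real.pi * t - Real.sin (4 * Real.pi * t) / 4) *
    (Real.pi * (1 - Real.cos (4 * Real.pi * t)))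

lemma hasDerivAt_profile (t : ℝ) : HasDerivAt profile (profileDeriv t) t := by
  have h1 : HasDerivAt (fun t : ℝ ↦ 4 * Real.pi * t) (4 * Real.pi) t := by
    simpa using (hasDerivAt_id t).const_mul (4 * Real.pi)
  have h2 : HasDerivAt (fun t : ℝ ↦ Real.pi * t) Real.pi t := by
    simpa using (hasDerivAt_id t).const_mul Real.pi
  refine ((h2.sub (h1.sin.div_const 4)).sin).congr_deriv ?_
  simp only [profileDeriv, Pi.sub_apply]
  ring

lemma abs_profile_le_one (t : ℝ) : |profile t| ≤ 1 := Real.abs_sin_le_one _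

lemma profile_int (k : ℤ) : profile k = 0 := by
  have h : Real.sin (4 * Real.pi * k) = 0 := by
    rw [show 4 * Real.pi * k = ((4 * k : ℤ) : ℝ) * Real.pi by push_cast; ring]
    exact Real.sin_int_mul_pi _
  rw [profile, h, zero_div, sub_zero, mul_comm]
  exact Real.sin_int_mul_pi k

/-- The oscillating correction to the phase `πt` serves to produce the factor `1 - cos (4πt)`, which
vanishes here. -/
lemma profileDeriv_int (k : ℤ) : profileDeriv k = 0 := by
  have h : Real.cos (4 * Real.pi * k) = 1 := by
    rw [show 4 * Real.pi * k = ((2 * k : ℤ) : ℝ) * (2 * Real.pi) by push_cast; ring]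
    exact Real.cos_int_mul_two_pi _
  rw [profileDeriv, h, sub_self, mul_zero, mul_zero]

/-- A half-step shift adds a quarter turn to the phase, exchanging sine and cosine up to sign; both
sums of squares below follow. -/
lemma phase_add_half (t : ℝ) :
    Real.pi * (t + 1 / 2) - Real.sin (4 * Real.pi * (t + 1 / 2)) / 4 =
      Real.pi * t - Real.sin (4 * Real.pi * t) / 4 + Real.pi / 2 := by
  rw [show 4 * Real.pi * (t + 1 / 2) = 4 * Real.pi * t + 2 * Real.pi by ring, Real.sin_add_two_pi]
  ring

lemma profile_sq_add (t : ℝ) : profile t ^ 2 + profile (t + 1 / 2) ^ 2 = 1 := by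
  rw [profile, profile, phase_add_half, Real.sin_add_pi_div_two]
  exact Real.sin_sq_add_cos_sq _

lemma profileDeriv_sq_add_le (t : ℝ) :
    profileDeriv t ^ 2 + profileDeriv (t + 1 / 2) ^ 2 ≤ 4 * Real.pi ^ 2 := by
  rw [profileDeriv, profileDeriv, phase_add_half, Real.cos_add_pi_div_two,
    show 4 * Real.pi * (t + 1 / 2) = 4 * Real.pi * t + 2 * Real.pi by ring, Real.cos_add_two_pi]
  set a := Real.pi * t - Real.sin (4 * Real.pi * t) / 4
  set c := Real.cos (4 * Real.pi * t)
  have h : (1 - c) ^ 2 ≤ 4 := by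
    have h1 := Real.neg_one_le_cos (4 * Real.pi * t)
    have h2 := Real.cos_le_one (4 * Real.pi * t)
    nlinarith
  calc (Real.cos a * (Real.pi * (1 - c))) ^ 2 + (-Real.sin a * (Real.pi * (1 - c))) ^ 2
      = (Real.sin a ^ 2 + Real.cos a ^ 2) * ((1 - c) ^ 2 * Real.pi ^ 2) := by ring
    _ ≤ 4 * Real.pi ^ 2 := by
      rw [Real.sin_sq_add_cos_sq, one_mul]
      gcongr

lemma abs_profileDeriv_le (t : ℝ) : |profileDeriv t| ≤ 2 * Real.pi := by
  refine abs_le_of_sq_le_sq ?_ (by positivity)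
  have := profileDeriv_sq_add_le t
  nlinarith [sq_nonneg (profileDeriv (t + 1 / 2))]

/-- The `j`-th coordinate with respect to the grid of mesh `s` with offset `-s c`. -/
def gridCoord (s : ℝ) (c : Fin 2 → ℝ) (j : Fin 2) (x : Plane) : ℝ := x j / s + c j

/-- The index of the cell containing `x`, in the grid of mesh `s` with offset `-s c`. -/
def gridIndex (s : ℝ) (c : Fin 2 → ℝ) (x : Plane) : ℤ × ℤ :=
  (⌊gridCoord s c 0 x⌋, ⌊gridCoord s c 1 x⌋)

/-- The open cells of the grid of mesh `s` with offset `-s c`. -/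
def gridSquare (s : ℝ) (c : Fin 2 → ℝ) (k : ℤ × ℤ) : Set Plane :=
  openRect !₂[s * (k.1 - c 0), s * (k.2 - c 1)] !₂[s * (k.1 + 1 - c 0), s * (k.2 + 1 - c 1)]

/-- The cutoff function of the grid. -/
def cutoff (s : ℝ) (c : Fin 2 → ℝ) (x : Plane) : ℝ :=
  profile (gridCoord s c 0 x) * profile (gridCoord s c 1 x)

/-- The partial derivatives of the cutoff function. -/
def cutoffDeriv (s : ℝ) (c : Fin 2 → ℝ) (j : Fin 2) (x : Plane) : ℝ :=
  profileDeriv (gridCoord s c j x) / s * profile (gridCoord s c (1 - j) x)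

/-- The coordinate linear forms. -/
def coordForm (j : Fin 2) : Plane →L[ℝ] ℝ := EuclideanSpace.proj j

lemma coordForm_e (i j : Fin 2) : coordForm i (e j) = if i = j then 1 else 0 := by
  simp [coordForm, e]

lemma hasFDerivAt_cutoff (s : ℝ) (c : Fin 2 → ℝ) (x : Plane) :
    HasFDerivAt (cutoff s c) (∑ j, cutoffDeriv s c j x • coordForm j) x := by
  have h (j : Fin 2) : HasFDerivAt (fun y ↦ profile (gridCoord s c j y))
      ((profileDeriv (gridCoord s c j x) / s) • coordForm j) x := by
    have h1 : HasFDerivAt (gridCoord s c j) (s⁻¹ • coordForm j) x := by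
      have := ((coordForm j).hasFDerivAt (x := x)).const_smul s⁻¹
      refine (this.add_const (c j)).congr_of_eventuallyEq (Eventually.of_forall fun y ↦ ?_)
      simp [gridCoord, coordForm, div_eq_inv_mul]
    refine ((hasDerivAt_profile (gridCoord s c j x)).comp_hasFDerivAt x h1).congr_fderiv ?_
    rw [smul_smul, div_eq_mul_inv]
  refine ((h 0).mul (h 1)).congr_fderiv ?_
  simp only [Fin.sum_univ_two, cutoffDeriv, smul_smul]
  rw [add_comm]
  congr 2 <;> exact mul_comm _ _

lemma fderiv_cutoff_e (s : ℝ) (c : Fin 2 → ℝ) (x : Plane) (j : Fin 2) :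
    (∑ i, cutoffDeriv s c i x • coordForm i) (e j) = cutoffDeriv s c j x := by
  fin_cases j <;> simp [coordForm_e]

lemma abs_cutoff_le_one (s : ℝ) (c : Fin 2 → ℝ) (x : Plane) : |cutoff s c x| ≤ 1 := by
  rw [cutoff, abs_mul]
  exact mul_le_one₀ (abs_profile_le_one _) (abs_nonneg _) (abs_profile_le_one _)

lemma abs_cutoffDeriv_le {s : ℝ} (hs : 0 < s) (c : Fin 2 → ℝ) (j : Fin 2) (x : Plane) :
    |cutoffDeriv s c j x| ≤ 2 * Real.pi / s := by
  rw [cutoffDeriv, abs_mul, abs_div, abs_of_pos hs]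
  refine (mul_le_of_le_one_right (by positivity) (abs_profile_le_one _)).trans ?_
  gcongr
  exact abs_profileDeriv_le _

/-- The four offsets of the grids. -/
def offset (a : Fin 2 × Fin 2) : Fin 2 → ℝ := ![(a.1 : ℕ) / 2, (a.2 : ℕ) / 2]

lemma sum_cutoff_sq (s : ℝ) (x : Plane) : ∑ a, cutoff s (offset a) x ^ 2 = 1 := by
  have h0 := profile_sq_add (x 0 / s)
  have h1 := profile_sq_add (x 1 / s)
  simp only [Fintype.sum_prod_type, Fin.sum_univ_two, cutoff, gridCoord, offset]
  simp
  simp only [one_div] at h0 h1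
  linear_combination h0 * (profile (x 1 / s) ^ 2 + profile (x 1 / s + 2⁻¹) ^ 2) + h1

/-- For each direction the sum over offsets factors into a derivative sum, at most `4π²`, and a
profile sum, equal to 1. -/
lemma sum_cutoffDeriv_sq_le {s : ℝ} (hs : 0 < s) (x : Plane) :
    ∑ a, ∑ j, cutoffDeriv s (offset a) j x ^ 2 ≤ 8 * Real.pi ^ 2 / s ^ 2 := by
  have h0 := profile_sq_add (x 0 / s)
  have h1 := profile_sq_add (x 1 / s)
  have d0 := profileDeriv_sq_add_le (x 0 / s)
  have d1 := profileDeriv_sq_add_le (x 1 / s)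
  rw [le_div_iff₀ (by positivity)]
  simp only [one_div] at h0 h1 d0 d1
  have : (∑ a, ∑ j, cutoffDeriv s (offset a) j x ^ 2) * s ^ 2 =
      (profileDeriv (x 0 / s) ^ 2 + profileDeriv (x 0 / s + 2⁻¹) ^ 2) *
        (profile (x 1 / s) ^ 2 + profile (x 1 / s + 2⁻¹) ^ 2) +
      (profileDeriv (x 1 / s) ^ 2 + profileDeriv (x 1 / s + 2⁻¹) ^ 2) *
        (profile (x 0 / s) ^ 2 + profile (x 0 / s + 2⁻¹) ^ 2) := by
    simp only [Fintype.sum_prod_type, Fin.sum_univ_two, cutoffDeriv, gridCoord, offset]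
    simp
    field_simp
    ring
  rw [this, h0, h1]
  linarith

/-- Away from the lines of the grid the index is locally constant. -/
lemma cutoff_cases {s : ℝ} (hs : 0 < s) (c : Fin 2 → ℝ) (x : Plane) :
    (cutoff s c x = 0 ∧ ∀ j, cutoffDeriv s c j x = 0) ∨
      (x ∈ gridSquare s c (gridIndex s c x) ∧
        ∀ᶠ y in 𝓝 x, gridIndex s c y = gridIndex s c x) := by
  by_cases h : ∃ j, ((⌊gridCoord s c j x⌋ : ℤ) : ℝ) = gridCoord s c j x
  · left
    obtain ⟨j, hj⟩ := h
    have p0 : profile (gridCoord s c j x) = 0 := by rw [← hj]; exact profile_int _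
    have d0 : profileDeriv (gridCoord s c j x) = 0 := by rw [← hj]; exact profileDeriv_int _
    refine ⟨?_, fun i ↦ ?_⟩
    · fin_cases j <;> simp_all [cutoff]
    · fin_cases j <;> fin_cases i <;> simp_all [cutoffDeriv]
  · right
    push Not at h
    have hlt (j : Fin 2) : (⌊gridCoord s c j x⌋ : ℝ) < gridCoord s c j x ∧
        gridCoord s c j x < ⌊gridCoord s c j x⌋ + 1 :=
      ⟨lt_of_le_of_ne (Int.floor_le _) (h j), Int.lt_floor_add_one _⟩
    have hlow (j : Fin 2) : s * (⌊gridCoord s c j x⌋ - c j) < x j := by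
      rw [← lt_div_iff₀' hs]
      have := (hlt j).1
      simp only [gridCoord] at this ⊢
      linarith
    have hup (j : Fin 2) : x j < s * (⌊gridCoord s c j x⌋ + 1 - c j) := by
      rw [← div_lt_iff₀' hs]
      have := (hlt j).2
      simp only [gridCoord] at this ⊢
      linarith
    refine ⟨⟨hlow 0, hup 0, hlow 1, hup 1⟩, ?_⟩
    have hc (j : Fin 2) : ContinuousAt (gridCoord s c j) x := by unfold gridCoord; fun_prop
    have hev (j : Fin 2) : ∀ᶠ y in 𝓝 x, ⌊gridCoord s c j y⌋ = ⌊gridCoord s c j x⌋ := by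
      filter_upwards [(hc j).eventually_const_lt (hlt j).1, (hc j).eventually_lt_const (hlt j).2]
        with y h1 h2
      exact Int.floor_eq_iff.2 ⟨h1.le, h2⟩
    filter_upwards [hev 0, hev 1] with y h0 h1
    simp [gridIndex, h0, h1]

lemma gridIndex_eq_of_mem_gridSquare {s : ℝ} (hs : 0 < s) {c : Fin 2 → ℝ} {k : ℤ × ℤ} {x : Plane}
    (hx : x ∈ gridSquare s c k) : gridIndex s c x = k := by
  have h1 := (lt_div_iff₀' hs).2 hx.1
  have h2 := (div_lt_iff₀' hs).2 hx.2.1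
  have h3 := (lt_div_iff₀' hs).2 hx.2.2.1
  have h4 := (div_lt_iff₀' hs).2 hx.2.2.2
  dsimp at h1 h2 h3 h4
  ext
  · exact Int.floor_eq_iff.2 ⟨by simp only [gridCoord]; linarith, by simp only [gridCoord]; linarith⟩
  · exact Int.floor_eq_iff.2 ⟨by simp only [gridCoord]; linarith, by simp only [gridCoord]; linarith⟩

/-- The area of a half-open cell of the grid. -/
lemma volume_gridIndex_preimage_le {s : ℝ} (hs : 0 < s) (c : Fin 2 → ℝ) (k : ℤ × ℤ) :
    volume (gridIndex s c ⁻¹' {k}) ≤ ENNReal.ofReal (s ^ 2) := by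
  set a : Fin 2 → ℝ := ![s * (k.1 - c 0), s * (k.2 - c 1)]
  set b : Fin 2 → ℝ := ![s * (k.1 + 1 - c 0), s * (k.2 + 1 - c 1)]
  have hsub : gridIndex s c ⁻¹' {k} ⊆ (WithLp.ofLp : Plane → Fin 2 → ℝ) ⁻¹' (Icc a b) := by
    intro x hx
    rw [mem_preimage, mem_singleton_iff] at hx
    subst hx
    have l (j : Fin 2) : s * (⌊gridCoord s c j x⌋ - c j) ≤ x j := by
      rw [← le_div_iff₀' hs]
      have := Int.floor_le (gridCoord s c j x)
      simp only [gridCoord] at this ⊢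
      linarith
    have u (j : Fin 2) : x j ≤ s * (⌊gridCoord s c j x⌋ + 1 - c j) := by
      rw [← div_le_iff₀' hs]
      have := (Int.lt_floor_add_one (gridCoord s c j x)).le
      simp only [gridCoord] at this ⊢
      linarith
    refine ⟨fun j ↦ ?_, fun j ↦ ?_⟩ <;> fin_cases j
    exacts [l 0, l 1, u 0, u 1]
  refine (measure_mono hsub).trans ?_
  rw [(PiLp.volume_preserving_ofLp (Fin 2)).measure_preimage measurableSet_Icc.nullMeasurableSet,
    Real.volume_Icc_pi, Fin.prod_univ_two, ← ENNReal.ofReal_mul]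
  · apply ENNReal.ofReal_le_ofReal
    simp only [a, b, Matrix.cons_val_zero, Matrix.cons_val_one]
    apply le_of_eq
    ring
  · simp only [a, b, Matrix.cons_val_zero]
    nlinarith

lemma measurable_gridIndex (s : ℝ) (c : Fin 2 → ℝ) : Measurable (gridIndex s c) := by
  have (j : Fin 2) : Measurable (gridCoord s c j) := by unfold gridCoord; fun_prop
  exact (this 0).floor.prodMk (this 1).floor

/-! ### Gauged cutoff functions and the eigenvalue bound -/

/-- The cutoff function of the grid, restricted to the cells in `good` and multiplied there by the
phases `exp (i φ k)`. -/
def gaugedCutoff (s : ℝ) (c : Fin 2 → ℝ) (good : Set (ℤ × ℤ)) (φ : ℤ × ℤ → Plane → ℝ)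
    (x : Plane) : ℂ :=
  good.indicator (fun k ↦ (cutoff s c x : ℂ) * Complex.exp (φ k x * Complex.I)) (gridIndex s c x)

section

variable {s : ℝ} {c : Fin 2 → ℝ} {good : Set (ℤ × ℤ)} {φ : ℤ × ℤ → Plane → ℝ} {x : Plane}

lemma norm_gaugedCutoff_of_mem (h : gridIndex s c x ∈ good) :
    ‖gaugedCutoff s c good φ x‖ = |cutoff s c x| := by
  rw [gaugedCutoff, indicator_of_mem h, norm_mul, Complex.norm_exp_ofReal_mul_I, mul_one,
    Complex.norm_real, Real.norm_eq_abs]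

lemma norm_gaugedCutoff_le : ‖gaugedCutoff s c good φ x‖ ≤ |cutoff s c x| := by
  by_cases h : gridIndex s c x ∈ good
  · exact (norm_gaugedCutoff_of_mem h).le
  · rw [gaugedCutoff, indicator_of_notMem h, norm_zero]
    exact abs_nonneg _

/-- On a good cell the derivative of the phase cancels the potential term, leaving a unit complex
number times the gradient of the cutoff. -/
lemma hasFDerivAt_gaugedCutoff {Ω : Set Plane} {η : Plane → Plane →L[ℝ] ℝ} (hs : 0 < s)
    (hφ : ∀ k ∈ good, IsPrimitiveOn η (Ω ∩ gridSquare s c k) (φ k)) (hx : x ∈ Ω) :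
    ∃ L : Plane →L[ℝ] ℂ, HasFDerivAt (gaugedCutoff s c good φ) L x ∧
      ∀ v, ‖L v - Complex.I * gaugedCutoff s c good φ x * (η x v : ℂ)‖ ≤
        |(∑ j, cutoffDeriv s c j x • coordForm j) v| := by
  have hf := hasFDerivAt_cutoff s c x
  rcases cutoff_cases hs c x with ⟨h0, h1⟩ | ⟨hxQ, hev⟩
  · have hu : gaugedCutoff s c good φ x = 0 := by
      have := norm_gaugedCutoff_le (s := s) (c := c) (good := good) (φ := φ) (x := x)
      rwa [h0, abs_zero, norm_le_zero_iff] at this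
    refine ⟨0, ?_, fun v ↦ by simp [hu]⟩
    have hf0 : (∑ j, cutoffDeriv s c j x • coordForm j) = 0 := by simp [h1]
    rw [hf0] at hf
    -- On a grid line the function is dominated by the cutoff, which is `o(‖y - x‖)`: its derivative
    -- is zero whatever the phases on the adjacent cells.
    refine HasFDerivAt.of_isLittleO (((Asymptotics.isBigO_of_le _ fun y ↦ ?_).trans_isLittleO
      hf.isLittleO))
    simpa [hu, h0] using norm_gaugedCutoff_le
  · by_cases hg : gridIndex s c x ∈ good
    · set k := gridIndex s c x
      have hφx : HasFDerivAt (φ k) (η x) x := hφ k hg x ⟨hx, hxQ⟩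
      have hexp := ((Complex.ofRealCLM.hasFDerivAt.comp x hφx).mul_const Complex.I).cexp
      have hprod := (Complex.ofRealCLM.hasFDerivAt.comp x hf).mul hexp
      have heq : gaugedCutoff s c good φ =ᶠ[𝓝 x]
          fun y ↦ (cutoff s c y : ℂ) * Complex.exp (φ k y * Complex.I) := by
        filter_upwards [hev] with y hy
        rw [gaugedCutoff, hy, indicator_of_mem hg]
      refine ⟨_, hprod.congr_of_eventuallyEq heq, fun v ↦ ?_⟩
      rw [heq.self_of_nhds]
      generalize (∑ j, cutoffDeriv s c j x • coordForm j) = f'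
      have hE := Complex.norm_exp_ofReal_mul_I (φ k x)
      refine le_of_eq ?_
      rw [← Real.norm_eq_abs, ← Complex.norm_real, ← one_mul ‖((f' v : ℝ) : ℂ)‖, ← hE, ← norm_mul]
      congr 1
      simp
      ring
    · have heq : gaugedCutoff s c good φ =ᶠ[𝓝 x] fun _ ↦ 0 := by
        filter_upwards [hev] with y hy
        rw [gaugedCutoff, hy, indicator_of_notMem hg]
      refine ⟨0, (hasFDerivAt_const 0 x).congr_of_eventuallyEq heq, fun v ↦ ?_⟩
      simp [heq.self_of_nhds]

end

lemma IsClosedPotential.exists_norm_toDual_le {Ω : Set Plane} {A : OneForm}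
    (hA : IsClosedPotential Ω A) (hb : Bornology.IsBounded Ω) : ∃ M, ∀ x ∈ Ω, ‖A.toDual x‖ ≤ M := by
  have hc : ContinuousOn A.toDual (closure Ω) :=
    altToDual.continuous.comp_continuousOn hA.smooth.continuousOn
  obtain ⟨M, hM⟩ := hb.isCompact_closure.exists_bound_of_continuousOn hc
  exact ⟨M, fun x hx ↦ hM x (subset_closure hx)⟩

/-- Each grid yields a test function whose mass is that of the cutoff function outside the cells
that meet `P`. -/
lemma exists_testFunction {Ω P : Set Plane} {A : OneForm} (hA : IsClosedPotential Ω A)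
    (hΩ : IsOpen Ω) (hb : Bornology.IsBounded Ω) (hP : ∀ K ∈ holes Ω, (K ∩ P).Nonempty)
    {s : ℝ} (hs : 0 < s) (c : Fin 2 → ℝ) :
    ∃ (u : Plane → ℂ) (G : Fin 2 → Plane → ℂ), IsH1WithGradient Ω u G ∧
      (∀ x, gridIndex s c x ∉ gridIndex s c '' P → ‖u x‖ ^ 2 = cutoff s c x ^ 2) ∧
      ∀ x ∈ Ω, ∑ j, ‖G j x - Complex.I * u x * (A.coeff j x : ℂ)‖ ^ 2 ≤
        ∑ j, cutoffDeriv s c j x ^ 2 := by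
  have hex : ∀ k : ℤ × ℤ, ∃ φ, k ∈ (gridIndex s c '' P)ᶜ →
      IsPrimitiveOn A.toDual (Ω ∩ gridSquare s c k) φ := by
    intro k
    by_cases hk : k ∈ gridIndex s c '' P
    · exact ⟨0, fun h ↦ (h hk).elim⟩
    · obtain ⟨φ, hφ⟩ := hA.exists_primitive hΩ hP (disjoint_left.2 fun p hp hpP ↦
        hk ⟨p, hpP, gridIndex_eq_of_mem_gridSquare hs hp⟩)
      exact ⟨φ, fun _ ↦ hφ⟩
  choose φ hφ using hex
  obtain ⟨M, hM⟩ := hA.exists_norm_toDual_le hb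
  set u := gaugedCutoff s c (gridIndex s c '' P)ᶜ φ with hu
  have hd : ∀ x ∈ Ω, DifferentiableAt ℝ u x ∧
      ∀ v, ‖fderiv ℝ u x v - Complex.I * u x * (A.toDual x v : ℂ)‖ ≤
        |(∑ j, cutoffDeriv s c j x • coordForm j) v| := by
    intro x hx
    obtain ⟨L, hL, hL'⟩ := hasFDerivAt_gaugedCutoff hs hφ hx
    exact ⟨hL.differentiableAt, by rwa [hL.fderiv]⟩
  have hu1 (x : Plane) : ‖u x‖ ≤ 1 := norm_gaugedCutoff_le.trans (abs_cutoff_le_one s c x)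
  have hgrad : ∀ x ∈ Ω, ‖fderiv ℝ u x‖ ≤ 2 * (2 * Real.pi / s) + max M 0 := by
    intro x hx
    refine ContinuousLinearMap.opNorm_le_bound _ (by positivity) fun v ↦ ?_
    have h1 : |(∑ j, cutoffDeriv s c j x • coordForm j) v| ≤ 2 * (2 * Real.pi / s) * ‖v‖ := by
      have hj (j : Fin 2) : |cutoffDeriv s c j x * v j| ≤ 2 * Real.pi / s * ‖v‖ := by
        rw [abs_mul]
        exact mul_le_mul (abs_cutoffDeriv_le hs c j x) (abs_coord_le_norm v j) (abs_nonneg _)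
          (by positivity)
      have hsum : (∑ j, cutoffDeriv s c j x • coordForm j) v =
          cutoffDeriv s c 0 x * v 0 + cutoffDeriv s c 1 x * v 1 := by
        simp [coordForm]
      rw [hsum]
      refine (abs_add_le _ _).trans ((add_le_add (hj 0) (hj 1)).trans_eq (by ring))
    have h2 : ‖Complex.I * u x * (A.toDual x v : ℂ)‖ ≤ max M 0 * ‖v‖ := by
      rw [norm_mul, norm_mul, Complex.norm_I, one_mul, Complex.norm_real]
      refine (mul_le_of_le_one_left (norm_nonneg _) (hu1 x)).trans ?_
      exact (A.toDual x).le_of_opNorm_le ((hM x hx).trans (le_max_left _ _)) v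
    have h3 := (hd x hx).2 v
    have h4 := norm_sub_norm_le (fderiv ℝ u x v) (Complex.I * u x * (A.toDual x v : ℂ))
    linarith
  refine ⟨u, _, isH1WithGradient_of_differentiableAt hΩ hb (fun x hx ↦ (hd x hx).1)
    (fun x _ ↦ hu1 x) hgrad, fun x hx ↦ ?_, fun x hx ↦ Finset.sum_le_sum fun j _ ↦ ?_⟩
  · rw [hu, norm_gaugedCutoff_of_mem hx, sq_abs]
  · have := (hd x hx).2 (e j)
    rw [fderiv_cutoff_e, OneForm.toDual_e] at this
    rw [← sq_abs (cutoffDeriv s c j x)]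
    gcongr

/-- The bound for the first eigenvalue given by the grids of mesh `s`. -/
lemma lambda1_mul_volume_sub_le {Ω : Set Plane} {P : Finset Plane} {A : OneForm}
    (hA : IsClosedPotential Ω A) (hΩ : IsOpen Ω) (hb : Bornology.IsBounded Ω)
    (hP : ∀ K ∈ holes Ω, (K ∩ P).Nonempty) {s : ℝ} (hs : 0 < s) :
    lambda1 Ω A * ((volume Ω).toReal - 4 * (P.card * s ^ 2)) ≤
      8 * Real.pi ^ 2 / s ^ 2 * (volume Ω).toReal := by
  have hfin : IsFiniteMeasure (volume.restrict Ω) :=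
    isFiniteMeasure_restrict.2 hb.measure_lt_top.ne
  choose u G huG hmass hen using fun a ↦ exists_testFunction hA hΩ hb hP hs (offset a)
  set bad : Fin 2 × Fin 2 → Set Plane := fun a ↦
    gridIndex s (offset a) ⁻¹' (gridIndex s (offset a) '' P) with hbad
  have hbadm (a) : MeasurableSet (bad a) :=
    measurable_gridIndex s (offset a) ((P.finite_toSet.image _).measurableSet)
  have hbadv (a) : (volume.restrict Ω).real (bad a) ≤ P.card * s ^ 2 := by
    -- Each point of `P` spoils one cell per grid.
    have h1 : volume (bad a) ≤ P.card * ENNReal.ofReal (s ^ 2) := by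
      have : bad a ⊆ ⋃ p ∈ P, gridIndex s (offset a) ⁻¹' {gridIndex s (offset a) p} := by
        rintro x ⟨p, hp, hpx⟩
        exact mem_biUnion (x := p) hp hpx.symm
      refine (measure_mono this).trans ((measure_biUnion_finset_le _ _).trans ?_)
      refine (Finset.sum_le_sum fun p _ ↦
        volume_gridIndex_preimage_le hs (offset a) (gridIndex s (offset a) p)).trans ?_
      simp
    have h2 := (Measure.restrict_apply_le Ω (bad a)).trans h1
    refine (ENNReal.toReal_mono (by finiteness) h2).trans_eq ?_
    rw [ENNReal.toReal_mul, ENNReal.toReal_natCast, ENNReal.toReal_ofReal (by positivity)]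
  have hui (a) : Integrable (fun x ↦ ‖u a x‖ ^ 2) (volume.restrict Ω) :=
    (huG a).memLp.integrable_norm_pow two_ne_zero
  have hbi (a) : Integrable ((bad a).indicator fun _ ↦ (1 : ℝ)) (volume.restrict Ω) :=
    (integrable_const 1).indicator (hbadm a)
  have hM : (volume Ω).toReal - 4 * (P.card * s ^ 2) ≤ ∑ a, ∫ x in Ω, ‖u a x‖ ^ 2 := by
    -- At each point the squared cutoffs sum to 1, and each grid in which the point is bad loses at
    -- most 1.
    have hpt : ∀ x, 1 - ∑ a, (bad a).indicator (fun _ ↦ (1 : ℝ)) x ≤ ∑ a, ‖u a x‖ ^ 2 := by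
      intro x
      suffices ∑ a, cutoff s (offset a) x ^ 2 - ∑ a, (bad a).indicator (fun _ ↦ (1 : ℝ)) x ≤
          ∑ a, ‖u a x‖ ^ 2 by rwa [sum_cutoff_sq] at this
      rw [← Finset.sum_sub_distrib]
      refine Finset.sum_le_sum fun a _ ↦ ?_
      by_cases hx : x ∈ bad a
      · rw [indicator_of_mem hx]
        have := (sq_le_one_iff_abs_le_one _).2 (abs_cutoff_le_one s (offset a) x)
        nlinarith [sq_nonneg ‖u a x‖]
      · rw [indicator_of_notMem hx, sub_zero, hmass a x hx]
    have hi := integral_mono (μ := volume.restrict Ω)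
      ((integrable_const 1).sub (integrable_finsetSum _ fun a _ ↦ hbi a))
      (integrable_finsetSum _ fun a _ ↦ hui a) hpt
    rw [integral_finsetSum _ fun a _ ↦ hui a] at hi
    refine le_trans ?_ hi
    simp only [Pi.sub_apply]
    rw [integral_sub (integrable_const 1) (integrable_finsetSum _ fun a _ ↦ hbi a),
      integral_finsetSum _ fun a _ ↦ hbi a]
    have hsum : ∑ a, ∫ x in Ω, (bad a).indicator (fun _ ↦ (1 : ℝ)) x ≤ 4 * (P.card * s ^ 2) := by
      refine (Finset.sum_le_sum fun a _ ↦ ?_ : _ ≤ ∑ _a : Fin 2 × Fin 2, P.card * s ^ 2).trans_eq ?_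
      · rw [integral_indicator_const _ (hbadm a), smul_eq_mul, mul_one]
        exact hbadv a
      · simp
    have hone : ∫ _ in Ω, (1 : ℝ) = (volume Ω).toReal := by simp [Measure.real]
    linarith
  have hE : ∑ a, magneticEnergy Ω A (u a) (G a) ≤
      8 * Real.pi ^ 2 / s ^ 2 * (volume Ω).toReal := by
    have hdi (a) : Integrable (fun x ↦ ∑ j, cutoffDeriv s (offset a) j x ^ 2)
        (volume.restrict Ω) := by
      refine integrable_finsetSum _ fun j _ ↦ ?_
      refine Integrable.of_bound (C := (2 * Real.pi / s) ^ 2) ?_ (ae_of_all _ fun x ↦ ?_)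
      · refine Continuous.aestronglyMeasurable ?_
        unfold cutoffDeriv profileDeriv profile gridCoord
        fun_prop
      · rw [Real.norm_eq_abs, abs_pow]
        gcongr
        exact abs_cutoffDeriv_le hs _ _ _
    calc ∑ a, magneticEnergy Ω A (u a) (G a)
        ≤ ∑ a, ∫ x in Ω, ∑ j, cutoffDeriv s (offset a) j x ^ 2 := by
          refine Finset.sum_le_sum fun a _ ↦ integral_mono_of_nonneg
            (ae_of_all _ fun x ↦ by positivity) (hdi a)
            ((ae_restrict_iff' hΩ.measurableSet).2 (ae_of_all _ (hen a)))
      _ = ∫ x in Ω, ∑ a, ∑ j, cutoffDeriv s (offset a) j x ^ 2 :=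
          (integral_finsetSum _ fun a _ ↦ hdi a).symm
      _ ≤ ∫ _ in Ω, 8 * Real.pi ^ 2 / s ^ 2 :=
          integral_mono (integrable_finsetSum _ fun a _ ↦ hdi a) (integrable_const _)
            fun x ↦ sum_cutoffDeriv_sq_le hs x
      _ = 8 * Real.pi ^ 2 / s ^ 2 * (volume Ω).toReal := by
          simp [Measure.real, mul_comm]
  calc lambda1 Ω A * ((volume Ω).toReal - 4 * (P.card * s ^ 2))
      ≤ lambda1 Ω A * ∑ a, ∫ x in Ω, ‖u a x‖ ^ 2 :=
        mul_le_mul_of_nonneg_left hM (lambda1_nonneg Ω A)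
    _ = ∑ a, lambda1 Ω A * ∫ x in Ω, ‖u a x‖ ^ 2 := Finset.mul_sum _ _ _
    _ ≤ ∑ a, magneticEnergy Ω A (u a) (G a) := Finset.sum_le_sum fun a _ ↦ lambda1_mul_le (huG a)
    _ ≤ _ := hE

/-- A finite set with one point in each hole. -/
lemma exists_finset_meeting_holes {Ω : Set Plane} {n : ℕ} (hn : (holes Ω).encard = n) :
    ∃ P : Finset Plane, P.card ≤ n ∧ ∀ K ∈ holes Ω, (K ∩ P).Nonempty := by
  classical
  have hfin : (holes Ω).Finite := finite_of_encard_eq_coe hn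
  have hne : ∀ K, ∃ p : Plane, K ∈ holes Ω → p ∈ K := by
    intro K
    by_cases hK : K ∈ holes Ω
    · obtain ⟨-, x, hx, rfl⟩ := hK
      exact ⟨x, fun _ ↦ mem_connectedComponentIn hx⟩
    · exact ⟨0, fun h ↦ (hK h).elim⟩
  choose p hp using hne
  refine ⟨hfin.toFinset.image p, Finset.card_image_le.trans ?_, fun K hK ↦ ⟨p K, hp K hK, ?_⟩⟩
  · rw [hfin.encard_eq_coe_toFinset_card] at hn
    exact_mod_cast hn.le
  · simpa using ⟨K, hK, rfl⟩

end MagneticNeumann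

end

/-! ### Choice of the mesh -/

theorem theorem1 (Ω : Set MagneticNeumann.Plane) (n : ℕ) (A : MagneticNeumann.OneForm)
    (hΩ : MagneticNeumann.IsSmoothBoundedDomain Ω)
    (hn : (MagneticNeumann.holes Ω).encard = n)
    (hA : MagneticNeumann.IsClosedPotential Ω A) :
    MagneticNeumann.lambda1 Ω A ≤ 544 * Real.pi * (n / (volume Ω).toReal) := by
  obtain ⟨P, hPn, hP⟩ := MagneticNeumann.exists_finset_meeting_holes hn
  set V := (volume Ω).toReal with hVdef
  have hV : 0 < V := ENNReal.toReal_pos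
    (hΩ.isOpen.measure_pos volume hΩ.isConnected.nonempty).ne' hΩ.isBounded.measure_lt_top.ne
  set l := MagneticNeumann.lambda1 Ω A
  have hl : 0 ≤ l := MagneticNeumann.lambda1_nonneg Ω A
  -- Here `t` is the area `s²` of a grid square.
  have key : ∀ t : ℝ, 0 < t → l * (V - 4 * (n * t)) ≤ 8 * Real.pi ^ 2 / t * V := by
    intro t ht
    have h := MagneticNeumann.lambda1_mul_volume_sub_le hA hΩ.isOpen hΩ.isBounded hP
      (Real.sqrt_pos.2 ht)
    rw [Real.sq_sqrt ht.le] at h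
    refine le_trans (mul_le_mul_of_nonneg_left ?_ hl) h
    have : (P.card : ℝ) ≤ n := by exact_mod_cast hPn
    gcongr
  rcases Nat.eq_zero_or_pos n with rfl | hn0
  · rw [Nat.cast_zero, zero_div, mul_zero]
    by_contra! hpos
    -- Without holes this `t` gives `l * V ≤ l * V / 2`, impossible for `l > 0`.
    have h := key (16 * Real.pi ^ 2 / l) (by positivity)
    have : 8 * Real.pi ^ 2 / (16 * Real.pi ^ 2 / l) = l / 2 := by
      field_simp
      norm_num
    rw [this] at h
    simp only [Nat.cast_zero, zero_mul, mul_zero, sub_zero] at h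
    nlinarith
  · have hnpos : (0 : ℝ) < n := by exact_mod_cast hn0
    -- With this `t` the lost area is at most `V / 2`, leaving `l * V ≤ 128 π² n`. Then `π ≤ 4`
    -- gives `512 π n`, within the stated constant.
    have h := key (V / (8 * n)) (by positivity)
    have e1 : V - 4 * (n * (V / (8 * n))) = V / 2 := by field_simp; ring
    have e2 : 8 * Real.pi ^ 2 / (V / (8 * n)) * V = 64 * Real.pi * Real.pi * n := by
      field_simp; ring
    rw [e1, e2] at h
    rw [← mul_div_assoc, le_div_iff₀ hV]
    have : Real.pi * (Real.pi * n) ≤ 4 * (Real.pi * n) :=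
      mul_le_mul_of_nonneg_right Real.pi_le_four (by positivity)
    nlinarith [Real.pi_pos, mul_pos Real.pi_pos hnpos]
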